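/- Let $a>0$, $b\in\mathbb R$, $|c|<\frac14$ and $T\ge 1.99$. Put $t(x)=\frac a2\left(x+\frac ba\right)^2$, so that the domain $x\ge -\frac ba+\sqrt{\frac{2T}{a}}$ corresponds to $t\ge T$. With $\operatorname{erfc}(z)=\frac{2}{\sqrt\pi}\int_z^\infty e^{-u^2}\,du$, define $$I_0(t)=1-\sqrt{\pi t}\,e^{t}\operatorname{erfc}(\sqrt t),\qquad J_0(t)=1-\sqrt{2\pi t}\,e^{2t}\operatorname{erfc}(\sqrt{2t}),$$ $$q_0(t)=2c\sqrt t\,e^{-t}I_0(t)+c^2e^{-2t}\left(2J_0(t)-I_0(t)-I_0(t)^2\right).$$ Then the Blasius equation $F'''+FF''=0$ has, on the domain $x\ge-\frac ba+\sqrt{\frac{2T}{a}}$, exactly one solution of the form $$F(x)=ax+b+\sqrt{\frac{a}{2t(x)}}\;q(t(x))$$ with $\lim_{t\to\infty}\frac{q(t)}{\sqrt t}=0$ and with the given $c$ as the coefficient of its leading exponential, that is, $q(t)\sim c\,\frac{e^{-t}}{\sqrt t}$ in the sense that $\lim_{t\to\infty}\sqrt t\,e^{t}q(t)=c$. Moreover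 $q(t)=q_0(t)+\mathcal E(t)$ for $t\ge T$, where $\mathcal E$ is three times continuously differentiable on $[T,\infty)$ and satisfies, for all $t\ge T$ (with one-sided derivatives at $t=T$), $$|\mathcal E(t)|\le 1.6667\times10^{-4}\,\frac{e^{-3t}}{9t^{3/2}},\qquad \left|\mathcal E'(t)-\frac1{2t}\mathcal E(t)\right|\le 1.6667\times10^{-4}\,\frac{e^{-3t}}{3t^{3/2}},$$ $$\left|\sqrt t\,\mathcal E''(t)-\frac1{\sqrt t}\mathcal E'(t)+\frac1{2t^{3/2}}\mathcal E(t)\right|\le 1.6667\times10^{-4}\,t^{-1}e^{-3t},$$ and also $$\left|\sqrt t\,\mathcal E''(t)-\frac1{2\sqrt t}\mathcal E'(t)+\frac1{2t^{3/2}}\mathcal E(t)\right|\le 1.6667\times10^{-4}\,t^{-1}e^{-3t}.$$ -/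

import Mathlib

open Set Filter Topology MeasureTheory

namespace Blasius

noncomputable section

/-- The complementary error function `erfc x = (2 / √π) ∫_x^∞ e^{-u²} du`. -/
def erfc (x : ℝ) : ℝ :=
  2 / Real.sqrt Real.pi * ∫ u in Ioi x, Real.exp (-u ^ 2)

/-- The independent variable `t(x) = (a / 2) (x + b / a)²`. -/
def tVar (a b x : ℝ) : ℝ := a / 2 * (x + b / a) ^ 2

/-- `I₀(t) = 1 - √(π t) e^t erfc(√t)`. -/
def I₀ (t : ℝ) : ℝ :=
  1 - Real.sqrt (Real.pi * t) * Real.exp t * erfc (Real.sqrt t)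

/-- `J₀(t) = 1 - √(2 π t) e^{2t} erfc(√(2t))`. -/
def J₀ (t : ℝ) : ℝ :=
  1 - Real.sqrt (2 * Real.pi * t) * Real.exp (2 * t) * erfc (Real.sqrt (2 * t))

/-- The quasi-solution `q₀(t) = 2 c √t e^{-t} I₀ + c² e^{-2t} (2 J₀ - I₀ - I₀²)`. -/
def q₀ (c t : ℝ) : ℝ :=
  2 * c * Real.sqrt t * Real.exp (-t) * I₀ t
    + c ^ 2 * Real.exp (-2 * t) * (2 * J₀ t - I₀ t - I₀ t ^ 2)

/-- `F` is a classical solution of `F''' + F F'' = 0` on the set `s` (used for closed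
half-lines, where the derivatives at the end point are one-sided). -/
def IsSolutionOn (F : ℝ → ℝ) (s : Set ℝ) : Prop :=
  ContDiffOn ℝ 3 F s ∧
    ∀ x ∈ s, iteratedDerivWithin 3 F s x + F x * iteratedDerivWithin 2 F s x = 0

/-- The `x`-domain `x ≥ -b/a + √(2T/a)`, which corresponds to `t(x) ≥ T`. -/
def xDomain (a b T : ℝ) : Set ℝ := Ici (-b / a + Real.sqrt (2 * T / a))

/-- `F` solves the Blasius equation on the domain `x ≥ -b/a + √(2T/a)`, it is there of the form
`F(x) = a x + b + √(a / (2 t(x))) q(t(x))` with `q(t) / √t → 0` as `t → ∞`, and the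
constant `c` is the coefficient of `e^{-t} / √t` in the leading asymptotics of `q`. -/
structure IsFarFieldSolution (a b c T : ℝ) (F q : ℝ → ℝ) : Prop where
  solution : IsSolutionOn F (xDomain a b T)
  form : ∀ x ∈ xDomain a b T,
    F x = a * x + b + Real.sqrt (a / (2 * tVar a b x)) * q (tVar a b x)
  decay : Tendsto (fun t : ℝ => q t / Real.sqrt t) atTop (𝓝 0)
  leading : Tendsto (fun t : ℝ => q t / (Real.exp (-t) / Real.sqrt t)) atTop (𝓝 c)

end

end Blasius

namespace Blasius

/-! ### Comparison of functions vanishing at infinity -/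

/-! Put `y = √(2t) = √a (x + b/a)` and `q = y h`. Then `F = √a (y + h(y))`, and the Blasius equation
becomes `h''' + (y + h) h'' = 0`, so `h'' e^{y²/2} e^{∫ h}` is constant. For a decaying `h`, with
`H(y) = ∫_y^∞ h` and thus `H' = -h`, this integrates to `H''' = -E e^{-y²/2} e^H`. The constant is
`E = √2 c`, read off from the leading asymptotics `h ~ E e^{-y²/2} / y²` (`tendsto_leading`).
Far-field solutions therefore correspond to solutions of this equation for which `H`, `H'`, `H''`
vanish at infinity, that is, to fixed points of a triple tail integral
(`isFarFieldSolution_of_decayChain`, `decayChain_of_isFarFieldSolution`).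

Existence is a contraction argument (`exists_decayChain`). Uniqueness is a Picard iteration applied
to the difference of two solutions (`DecayChain.eqOn_zero`).

For the error, expand in `E`: to first order `H` is `E` times the triple tail integral `gaussTail₃`
of the Gaussian, and `q₀ / y` is the function `quasi` with second derivative `E e^{-y²/2} (1 + E
gaussTail₃)`. The error `e = h - quasi` thus satisfies `e'' = E e^{-y²/2} (e^H - 1 - E gaussTail₃)`,
which is cubic in `E e^{-y²/2}` (`abs_error₂_le`). Integrating twice gives `e'` and `e`, and the
four combinations in the theorem are simple expressions in `e`, `e'`, `e''`.

All estimates use one comparison principle: for functions vanishing at infinity, a bound between the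
third derivatives passes to the functions (`DecayChain.abs_le`). No integral has to be estimated
directly. -/

lemma nonneg_of_deriv_nonpos {f f' : ℝ → ℝ} {p : ℝ}
    (hf : ∀ z ∈ Ici p, HasDerivWithinAt f (f' z) (Ici p) z)
    (h : ∀ z ∈ Ici p, f' z ≤ 0) (f0 : Tendsto f atTop (𝓝 0)) :
    ∀ y ∈ Ici p, 0 ≤ f y := by
  have anti : AntitoneOn f (Ici p) := by
    refine antitoneOn_of_hasDerivWithinAt_nonpos (f' := f') (convex_Ici p)
      (fun z hz => (hf z hz).continuousWithinAt) ?_ ?_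
    · intro z hz
      exact (hf z (interior_subset hz)).mono interior_subset
    · intro z hz
      exact h z (interior_subset hz)
  intro y hy
  refine le_of_tendsto f0 ?_
  filter_upwards [eventually_ge_atTop y] with z hz
  exact anti hy (le_trans hy hz) hz

/-- Both `g - f` and `g + f` are nonincreasing with limit zero, hence nonnegative. -/
lemma abs_le_of_abs_deriv_le {f f' g g' : ℝ → ℝ} {p : ℝ}
    (hf : ∀ z ∈ Ici p, HasDerivWithinAt f (f' z) (Ici p) z)
    (hg : ∀ z ∈ Ici p, HasDerivWithinAt g (g' z) (Ici p) z)
    (h : ∀ z ∈ Ici p, |f' z| ≤ -g' z)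
    (f0 : Tendsto f atTop (𝓝 0)) (g0 : Tendsto g atTop (𝓝 0)) :
    ∀ y ∈ Ici p, |f y| ≤ g y := by
  intro y hy
  have h1 := nonneg_of_deriv_nonpos (f := fun z => g z - f z) (f' := fun z => g' z - f' z)
    (fun z hz => (hg z hz).sub (hf z hz))
    (fun z hz => by linarith [h z hz, neg_abs_le (f' z)]) (by simpa using g0.sub f0) y hy
  have h2 := nonneg_of_deriv_nonpos (f := fun z => g z + f z) (f' := fun z => g' z + f' z)
    (fun z hz => (hg z hz).add (hf z hz))
    (fun z hz => by linarith [h z hz, le_abs_self (f' z)]) (by simpa using g0.add f0) y hy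
  exact abs_le.2 ⟨by linarith, by linarith⟩

/-- `f₀, f₁, f₂, f₃` are successive derivatives on `[p, ∞)`, the first three vanishing at
infinity. -/
structure DecayChain (p : ℝ) (f₀ f₁ f₂ f₃ : ℝ → ℝ) : Prop where
  d₀ : ∀ z ∈ Ici p, HasDerivWithinAt f₀ (f₁ z) (Ici p) z
  d₁ : ∀ z ∈ Ici p, HasDerivWithinAt f₁ (f₂ z) (Ici p) z
  d₂ : ∀ z ∈ Ici p, HasDerivWithinAt f₂ (f₃ z) (Ici p) z
  t₀ : Tendsto f₀ atTop (𝓝 0)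
  t₁ : Tendsto f₁ atTop (𝓝 0)
  t₂ : Tendsto f₂ atTop (𝓝 0)

namespace DecayChain

variable {p : ℝ} {f₀ f₁ f₂ f₃ g₀ g₁ g₂ g₃ : ℝ → ℝ}

lemma mono (hf : DecayChain p f₀ f₁ f₂ f₃) {r : ℝ} (hr : p ≤ r) :
    DecayChain r f₀ f₁ f₂ f₃ :=
  have hs : Ici r ⊆ Ici p := Ici_subset_Ici.2 hr
  ⟨fun z hz => (hf.d₀ z (hs hz)).mono hs, fun z hz => (hf.d₁ z (hs hz)).mono hs,
    fun z hz => (hf.d₂ z (hs hz)).mono hs, hf.t₀, hf.t₁, hf.t₂⟩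

lemma congr (hf : DecayChain p f₀ f₁ f₂ f₃) (h : EqOn g₃ f₃ (Ici p)) :
    DecayChain p f₀ f₁ f₂ g₃ :=
  ⟨hf.d₀, hf.d₁, fun z hz => by rw [h hz]; exact hf.d₂ z hz, hf.t₀, hf.t₁, hf.t₂⟩

lemma sub (hf : DecayChain p f₀ f₁ f₂ f₃) (hg : DecayChain p g₀ g₁ g₂ g₃) :
    DecayChain p (fun z => f₀ z - g₀ z) (fun z => f₁ z - g₁ z) (fun z => f₂ z - g₂ z)
      (fun z => f₃ z - g₃ z) :=
  ⟨fun z hz => (hf.d₀ z hz).sub (hg.d₀ z hz), fun z hz => (hf.d₁ z hz).sub (hg.d₁ z hz),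
    fun z hz => (hf.d₂ z hz).sub (hg.d₂ z hz), by simpa using hf.t₀.sub hg.t₀,
    by simpa using hf.t₁.sub hg.t₁, by simpa using hf.t₂.sub hg.t₂⟩

lemma const_mul (hf : DecayChain p f₀ f₁ f₂ f₃) (k : ℝ) :
    DecayChain p (fun z => k * f₀ z) (fun z => k * f₁ z) (fun z => k * f₂ z)
      (fun z => k * f₃ z) :=
  ⟨fun z hz => (hf.d₀ z hz).const_mul k, fun z hz => (hf.d₁ z hz).const_mul k,
    fun z hz => (hf.d₂ z hz).const_mul k, by simpa using hf.t₀.const_mul k,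
    by simpa using hf.t₁.const_mul k, by simpa using hf.t₂.const_mul k⟩

lemma comp_mul (hf : DecayChain p f₀ f₁ f₂ f₃) {k : ℝ} (hk : 0 < k) {r : ℝ} (hr : p ≤ k * r) :
    DecayChain r (fun z => f₀ (k * z)) (fun z => k * f₁ (k * z)) (fun z => k ^ 2 * f₂ (k * z))
      (fun z => k ^ 3 * f₃ (k * z)) := by
  have hm : MapsTo (fun z => k * z) (Ici r) (Ici p) := fun z hz =>
    hr.trans (mul_le_mul_of_nonneg_left hz hk.le)
  have hk' : ∀ z, HasDerivWithinAt (fun z => k * z) k (Ici r) z := fun z => by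
    simpa using ((hasDerivAt_id z).const_mul k).hasDerivWithinAt
  have hl : Tendsto (fun z => k * z) atTop atTop := tendsto_id.const_mul_atTop hk
  refine ⟨fun z hz => ?_, fun z hz => ?_, fun z hz => ?_, hf.t₀.comp hl,
    by simpa using (hf.t₁.comp hl).const_mul k, by simpa using (hf.t₂.comp hl).const_mul (k ^ 2)⟩
  · exact ((hf.d₀ _ (hm hz)).comp z (hk' z) hm).congr_deriv (by ring)
  · exact (((hf.d₁ _ (hm hz)).comp z (hk' z) hm).const_mul k).congr_deriv (by ring)
  · exact (((hf.d₂ _ (hm hz)).comp z (hk' z) hm).const_mul (k ^ 2)).congr_deriv (by ring)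

/-- Three applications of the comparison principle. Signs alternate along a decaying chain, so the
middle one compares with `-g₁`. -/
lemma abs_le (hf : DecayChain p f₀ f₁ f₂ f₃) (hg : DecayChain p g₀ g₁ g₂ g₃)
    (h : ∀ z ∈ Ici p, |f₃ z| ≤ -g₃ z) : ∀ y ∈ Ici p, |f₀ y| ≤ g₀ y := by
  have h2 := abs_le_of_abs_deriv_le hf.d₂ hg.d₂ h hf.t₂ hg.t₂
  have h1 := abs_le_of_abs_deriv_le hf.d₁ (fun z hz => (hg.d₁ z hz).neg)
    (by simpa using h2) hf.t₁ (by simpa [Pi.neg_def] using hg.t₁.neg)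
  exact abs_le_of_abs_deriv_le hf.d₀ hg.d₀ h1 hf.t₀ hg.t₀

end DecayChain

lemma tendsto_exp_neg_const_mul (k : ℝ) (hk : 0 < k) :
    Tendsto (fun y : ℝ => Real.exp (-(k * y))) atTop (𝓝 0) :=
  Real.tendsto_exp_neg_atTop_nhds_zero.comp (tendsto_id.const_mul_atTop hk)

lemma decayChain_exp (k : ℝ) (hk : 0 < k) (p : ℝ) :
    DecayChain p (fun y => Real.exp (-(k * y))) (fun y => -k * Real.exp (-(k * y)))
      (fun y => k ^ 2 * Real.exp (-(k * y))) (fun y => -k ^ 3 * Real.exp (-(k * y))) := by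
  have hd : ∀ z, HasDerivAt (fun y => Real.exp (-(k * y))) (-k * Real.exp (-(k * z))) z := by
    intro z
    have := (((hasDerivAt_id z).const_mul k).neg).exp
    simpa [mul_comm] using this
  have ht := tendsto_exp_neg_const_mul k hk
  refine ⟨fun z _ => (hd z).hasDerivWithinAt, fun z _ => ?_, fun z _ => ?_, ht,
    by simpa using ht.const_mul (-k), by simpa using ht.const_mul (k ^ 2)⟩
  · exact ((hd z).const_mul (-k)).hasDerivWithinAt.congr_deriv (by ring)
  · exact ((hd z).const_mul (k ^ 2)).hasDerivWithinAt.congr_deriv (by ring)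

/-! ### Tail integrals -/

/-- `∫_y^∞ g`. -/
noncomputable def tail (g : ℝ → ℝ) (y : ℝ) : ℝ := ∫ z in Ioi y, g z

section tail

variable {g : ℝ → ℝ} {C : ℝ}

lemma integrableOn_Ioi_of_exp_bound (hg : Continuous g) (hb : ∀ z, |g z| ≤ C * Real.exp (-z))
    (y : ℝ) : IntegrableOn g (Ioi y) := by
  refine Integrable.mono' ((integrableOn_exp_neg_Ioi y).const_mul C)
    hg.aestronglyMeasurable (ae_of_all _ hb)

lemma hasDerivAt_tail (hg : Continuous g) (hb : ∀ z, |g z| ≤ C * Real.exp (-z)) (y : ℝ) :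
    HasDerivAt (tail g) (-g y) y := by
  have hi := integrableOn_Ioi_of_exp_bound hg hb
  have e : tail g = fun y => tail g 0 - ∫ z in (0 : ℝ)..y, g z := by
    funext x
    have := intervalIntegral.integral_Ioi_sub_Ioi' (hi 0) (hi x)
    simp only [tail]
    linarith
  rw [e]
  simpa using (intervalIntegral.integral_hasDerivAt_right (hg.intervalIntegrable 0 y)
    (hg.stronglyMeasurableAtFilter _ _) hg.continuousAt).const_sub (tail g 0)

lemma continuous_tail (hg : Continuous g) (hb : ∀ z, |g z| ≤ C * Real.exp (-z)) :
    Continuous (tail g) :=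
  continuous_iff_continuousAt.2 fun y => (hasDerivAt_tail hg hb y).continuousAt

lemma abs_tail_le (hb : ∀ z, |g z| ≤ C * Real.exp (-z)) (y : ℝ) :
    |tail g y| ≤ C * Real.exp (-y) := by
  have := norm_integral_le_of_norm_le (μ := volume.restrict (Ioi y)) (f := g)
    ((integrableOn_exp_neg_Ioi y).const_mul C) (ae_of_all _ hb)
  rwa [integral_const_mul, integral_exp_neg_Ioi] at this

lemma tendsto_zero_of_exp_bound (hb : ∀ z, |g z| ≤ C * Real.exp (-z)) :
    Tendsto g atTop (𝓝 0) := by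
  refine squeeze_zero_norm hb ?_
  simpa using Real.tendsto_exp_neg_atTop_nhds_zero.const_mul C

/-- The source of chains with a prescribed third derivative; an exponential bound survives each tail
integration with the same constant. -/
lemma decayChain_tail (hg : Continuous g) (hb : ∀ z, |g z| ≤ C * Real.exp (-z)) (p : ℝ) :
    DecayChain p (tail (tail (tail g))) (fun y => -tail (tail g) y) (tail g)
      (fun y => -g y) := by
  have c1 := continuous_tail hg hb
  have b1 := abs_tail_le hb
  have c2 := continuous_tail c1 b1
  have b2 := abs_tail_le b1
  refine ⟨fun z _ => (hasDerivAt_tail c2 b2 z).hasDerivWithinAt, fun z _ => ?_,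
    fun z _ => (hasDerivAt_tail hg hb z).hasDerivWithinAt,
    tendsto_zero_of_exp_bound (abs_tail_le b2), by simpa using (tendsto_zero_of_exp_bound b2).neg,
    tendsto_zero_of_exp_bound b1⟩
  simpa [Pi.neg_def] using (hasDerivAt_tail c1 b1 z).neg.hasDerivWithinAt

end tail

/-! ### Iterated derivatives within a half-line -/

section iterated

variable {p : ℝ} {f₀ f₁ f₂ f₃ : ℝ → ℝ}

lemma eqOn_derivWithin_Ici (h : ∀ z ∈ Ici p, HasDerivWithinAt f₀ (f₁ z) (Ici p) z) :
    EqOn (derivWithin f₀ (Ici p)) f₁ (Ici p) :=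
  fun z hz => (h z hz).derivWithin (uniqueDiffOn_Ici p z hz)

lemma eqOn_iteratedDerivWithin_two (h₀ : ∀ z ∈ Ici p, HasDerivWithinAt f₀ (f₁ z) (Ici p) z)
    (h₁ : ∀ z ∈ Ici p, HasDerivWithinAt f₁ (f₂ z) (Ici p) z) :
    EqOn (iteratedDerivWithin 2 f₀ (Ici p)) f₂ (Ici p) := by
  intro z hz
  rw [iteratedDerivWithin_succ, iteratedDerivWithin_one]
  rw [derivWithin_congr (eqOn_derivWithin_Ici h₀) (eqOn_derivWithin_Ici h₀ hz)]
  exact eqOn_derivWithin_Ici h₁ hz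

lemma eqOn_iteratedDerivWithin_three (h₀ : ∀ z ∈ Ici p, HasDerivWithinAt f₀ (f₁ z) (Ici p) z)
    (h₁ : ∀ z ∈ Ici p, HasDerivWithinAt f₁ (f₂ z) (Ici p) z)
    (h₂ : ∀ z ∈ Ici p, HasDerivWithinAt f₂ (f₃ z) (Ici p) z) :
    EqOn (iteratedDerivWithin 3 f₀ (Ici p)) f₃ (Ici p) := by
  intro z hz
  rw [iteratedDerivWithin_succ]
  rw [derivWithin_congr (eqOn_iteratedDerivWithin_two h₀ h₁)
    (eqOn_iteratedDerivWithin_two h₀ h₁ hz)]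
  exact eqOn_derivWithin_Ici h₂ hz

lemma contDiffOn_three_of_hasDerivWithinAt
    (h₀ : ∀ z ∈ Ici p, HasDerivWithinAt f₀ (f₁ z) (Ici p) z)
    (h₁ : ∀ z ∈ Ici p, HasDerivWithinAt f₁ (f₂ z) (Ici p) z)
    (h₂ : ∀ z ∈ Ici p, HasDerivWithinAt f₂ (f₃ z) (Ici p) z)
    (h₃ : ContinuousOn f₃ (Ici p)) : ContDiffOn ℝ 3 f₀ (Ici p) := by
  have step : ∀ {n : ℕ} {u v : ℝ → ℝ}, (∀ z ∈ Ici p, HasDerivWithinAt u (v z) (Ici p) z) →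
      ContDiffOn ℝ n v (Ici p) → ContDiffOn ℝ (n + 1 : ℕ) u (Ici p) := by
    intro n u v hu hv
    push_cast
    refine (contDiffOn_succ_iff_derivWithin (uniqueDiffOn_Ici p)).2
      ⟨fun z hz => (hu z hz).differentiableWithinAt, by simp, ?_⟩
    exact hv.congr (eqOn_derivWithin_Ici hu)
  have c0 : ContDiffOn ℝ (0 : ℕ) f₃ (Ici p) := by simpa [contDiffOn_zero] using h₃
  exact_mod_cast step h₀ (step h₁ (step h₂ c0))

lemma hasDerivWithinAt_iteratedDerivWithin {f : ℝ → ℝ} {n : ℕ} {m : ℕ}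
    (hf : ContDiffOn ℝ n f (Ici p)) (hm : m < n) :
    ∀ z ∈ Ici p, HasDerivWithinAt (iteratedDerivWithin m f (Ici p))
      (iteratedDerivWithin (m + 1) f (Ici p) z) (Ici p) z := by
  intro z hz
  rw [iteratedDerivWithin_succ]
  exact ((hf.differentiableOn_iteratedDerivWithin (by exact_mod_cast hm)
    (uniqueDiffOn_Ici p)) z hz).hasDerivWithinAt

end iterated

end Blasius

namespace Blasius

/-! ### Gaussian tails -/

lemma exp_neg_sq_le (z : ℝ) : Real.exp (-z ^ 2) ≤ Real.exp 1 * Real.exp (-z) := by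
  rw [← Real.exp_add]
  exact Real.exp_le_exp.2 (by nlinarith [sq_nonneg (z - 1 / 2)])

lemma exp_neg_sq_half_le (z : ℝ) :
    Real.exp (-z ^ 2 / 2) ≤ Real.exp (1 / 2) * Real.exp (-z) := by
  rw [← Real.exp_add]
  exact Real.exp_le_exp.2 (by nlinarith [sq_nonneg (z - 1)])

lemma hasDerivAt_exp_neg_sq_half (y : ℝ) :
    HasDerivAt (fun y => Real.exp (-y ^ 2 / 2)) (-(y * Real.exp (-y ^ 2 / 2))) y := by
  have := (((hasDerivAt_id y).pow 2).neg.div_const 2).exp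
  refine this.congr_deriv ?_
  simp
  ring

lemma tendsto_pow_mul_exp_neg_sq_half (n : ℕ) :
    Tendsto (fun y : ℝ => y ^ n * Real.exp (-y ^ 2 / 2)) atTop (𝓝 0) := by
  have h := (Real.tendsto_pow_mul_exp_neg_atTop_nhds_zero n).const_mul (Real.exp (1 / 2))
  rw [mul_zero] at h
  refine squeeze_zero' ?_ ?_ h
  · filter_upwards [eventually_ge_atTop 0] with y hy
    positivity
  · filter_upwards [eventually_ge_atTop 0] with y hy
    have := mul_le_mul_of_nonneg_left (exp_neg_sq_half_le y) (pow_nonneg hy n)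
    linarith

lemma tendsto_exp_neg_sq_half : Tendsto (fun y : ℝ => Real.exp (-y ^ 2 / 2)) atTop (𝓝 0) := by
  simpa using tendsto_pow_mul_exp_neg_sq_half 0

/-- `∫_y^∞ e^{-z²/2} dz`. -/
noncomputable def gaussTail (y : ℝ) : ℝ :=
  Real.sqrt 2 * tail (fun u => Real.exp (-u ^ 2)) (y / Real.sqrt 2)

lemma abs_exp_neg_sq_le (z : ℝ) : |Real.exp (-z ^ 2)| ≤ Real.exp 1 * Real.exp (-z) := by
  rw [abs_of_pos (Real.exp_pos _)]
  exact exp_neg_sq_le z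

lemma hasDerivAt_gaussTail (y : ℝ) : HasDerivAt gaussTail (-Real.exp (-y ^ 2 / 2)) y := by
  have h := hasDerivAt_tail (g := fun u => Real.exp (-u ^ 2)) (by fun_prop) abs_exp_neg_sq_le
    (y / Real.sqrt 2)
  have h2 := (h.comp y ((hasDerivAt_id y).div_const (Real.sqrt 2))).const_mul (Real.sqrt 2)
  refine h2.congr_deriv ?_
  have : (-(y / Real.sqrt 2) ^ 2) = -y ^ 2 / 2 := by
    rw [div_pow, Real.sq_sqrt (by norm_num)]; ring
  rw [this]
  field_simp

lemma tendsto_gaussTail : Tendsto gaussTail atTop (𝓝 0) := by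
  have h := tendsto_zero_of_exp_bound (abs_tail_le abs_exp_neg_sq_le)
  have h2 : Tendsto (fun y : ℝ => y / Real.sqrt 2) atTop atTop :=
    tendsto_id.atTop_div_const (by positivity)
  have := (h.comp h2).const_mul (Real.sqrt 2)
  rw [mul_zero] at this
  exact this

lemma gaussTail_nonneg (y : ℝ) : 0 ≤ gaussTail y :=
  nonneg_of_deriv_nonpos (p := y) (fun z _ => (hasDerivAt_gaussTail z).hasDerivWithinAt)
    (fun z _ => by simpa using (Real.exp_pos _).le) tendsto_gaussTail y self_mem_Ici

/-- A convergent of the continued fraction of the Mills ratio. -/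
lemma gaussTail_le {y : ℝ} (hy : 0 < y) :
    gaussTail y ≤
      Real.exp (-y ^ 2 / 2) * ((y ^ 4 + 9 * y ^ 2 + 8) / (y ^ 5 + 10 * y ^ 3 + 15 * y)) := by
  have hD : ∀ z ∈ Ici y, 0 < z ^ 5 + 10 * z ^ 3 + 15 * z := fun z hz => by
    have : 0 < z := hy.trans_le hz
    positivity
  -- For this convergent, differentiation leaves only the nonnegative remainder `120 / D²` beside
  -- the integrand, so the candidate decreases at least as fast as `gaussTail`.
  have hd : ∀ z ∈ Ici y, HasDerivWithinAt
      (fun y => Real.exp (-y ^ 2 / 2) * ((y ^ 4 + 9 * y ^ 2 + 8) / (y ^ 5 + 10 * y ^ 3 + 15 * y)))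
      (-Real.exp (-z ^ 2 / 2) * (1 + 120 / (z ^ 5 + 10 * z ^ 3 + 15 * z) ^ 2)) (Ici y) z := by
    intro z hz
    have hN : HasDerivAt (fun y : ℝ => y ^ 4 + 9 * y ^ 2 + 8) (4 * z ^ 3 + 18 * z) z := by
      have := (((hasDerivAt_id z).pow 4).add (((hasDerivAt_id z).pow 2).const_mul 9)).add_const 8
      refine this.congr_deriv ?_
      simp; ring
    have hDd : HasDerivAt (fun y : ℝ => y ^ 5 + 10 * y ^ 3 + 15 * y)
        (5 * z ^ 4 + 30 * z ^ 2 + 15) z := by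
      have := (((hasDerivAt_id z).pow 5).add (((hasDerivAt_id z).pow 3).const_mul 10)).add
        ((hasDerivAt_id z).const_mul 15)
      refine this.congr_deriv ?_
      simp; ring
    have hne := (hD z hz).ne'
    have hz0 : z ≠ 0 := (hy.trans_le hz).ne'
    refine ((hasDerivAt_exp_neg_sq_half z).mul (hN.div hDd hne)).hasDerivWithinAt.congr_deriv ?_
    simp only [Pi.div_apply]
    field_simp
    ring
  refine (le_abs_self _).trans (abs_le_of_abs_deriv_le (p := y)
    (fun z _ => (hasDerivAt_gaussTail z).hasDerivWithinAt) hd ?_ tendsto_gaussTail ?_ y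
    self_mem_Ici)
  · intro z hz
    rw [abs_neg, abs_of_pos (Real.exp_pos _)]
    have : 0 ≤ 120 / (z ^ 5 + 10 * z ^ 3 + 15 * z) ^ 2 := by positivity
    nlinarith [Real.exp_pos (-z ^ 2 / 2)]
  · refine squeeze_zero' ?_ ?_ tendsto_exp_neg_sq_half
    · filter_upwards [eventually_ge_atTop 0] with z hz
      positivity
    · filter_upwards [eventually_ge_atTop 1] with z hz
      refine mul_le_of_le_one_right (Real.exp_pos _).le ?_
      rw [div_le_one (by positivity)]
      nlinarith [pow_le_pow_right₀ hz (show 4 ≤ 5 by norm_num),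
        pow_le_pow_right₀ hz (show 2 ≤ 3 by norm_num)]

lemma tendsto_pow_mul_gaussTail (n : ℕ) :
    Tendsto (fun y : ℝ => y ^ n * gaussTail y) atTop (𝓝 0) := by
  refine squeeze_zero' ?_ ?_ (tendsto_pow_mul_exp_neg_sq_half n)
  · filter_upwards [eventually_ge_atTop 0] with z hz
    exact mul_nonneg (by positivity) (gaussTail_nonneg z)
  · filter_upwards [eventually_ge_atTop 1] with z hz
    refine mul_le_mul_of_nonneg_left ((gaussTail_le (by linarith)).trans ?_) (by positivity)
    refine mul_le_of_le_one_right (Real.exp_pos _).le ?_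
    rw [div_le_one (by positivity)]
    nlinarith [pow_le_pow_right₀ hz (show 4 ≤ 5 by norm_num),
      pow_le_pow_right₀ hz (show 2 ≤ 3 by norm_num)]

/-- `∫_y^∞ (z - y)² / 2 e^{-z²/2} dz`. -/
noncomputable def gaussTail₃ (y : ℝ) : ℝ :=
  ((1 + y ^ 2) * gaussTail y - y * Real.exp (-y ^ 2 / 2)) / 2

lemma hasDerivAt_gaussTail₂ (y : ℝ) :
    HasDerivAt (fun y => y * gaussTail y - Real.exp (-y ^ 2 / 2)) (gaussTail y) y := by
  refine (((hasDerivAt_id y).mul (hasDerivAt_gaussTail y)).sub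
    (hasDerivAt_exp_neg_sq_half y)).congr_deriv ?_
  simp

lemma hasDerivAt_gaussTail₃ (y : ℝ) :
    HasDerivAt gaussTail₃ (y * gaussTail y - Real.exp (-y ^ 2 / 2)) y := by
  have hs : HasDerivAt (fun y : ℝ => 1 + y ^ 2) (2 * y) y := by
    simpa using ((hasDerivAt_id y).pow 2).const_add 1
  refine (((hs.mul (hasDerivAt_gaussTail y)).sub ((hasDerivAt_id y).mul
    (hasDerivAt_exp_neg_sq_half y))).div_const 2).congr_deriv ?_
  simp only [id]
  ring

lemma decayChain_gaussTail₃ (p : ℝ) :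
    DecayChain p gaussTail₃ (fun y => y * gaussTail y - Real.exp (-y ^ 2 / 2)) gaussTail
      (fun y => -Real.exp (-y ^ 2 / 2)) := by
  refine ⟨fun z _ => (hasDerivAt_gaussTail₃ z).hasDerivWithinAt,
    fun z _ => (hasDerivAt_gaussTail₂ z).hasDerivWithinAt,
    fun z _ => (hasDerivAt_gaussTail z).hasDerivWithinAt, ?_, ?_, tendsto_gaussTail⟩
  · have := (((tendsto_gaussTail.add (tendsto_pow_mul_gaussTail 2)).sub
      (tendsto_pow_mul_exp_neg_sq_half 1)).div_const 2)
    simp only [pow_one, add_zero, sub_zero, zero_div] at this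
    refine this.congr fun y => ?_
    rw [gaussTail₃]; ring
  · have := (tendsto_pow_mul_gaussTail 1).sub tendsto_exp_neg_sq_half
    simpa using this

lemma gaussTail₃_nonneg (y : ℝ) : 0 ≤ gaussTail₃ y := by
  have h := decayChain_gaussTail₃ y
  exact (abs_nonneg _).trans (h.abs_le h (fun z _ => by rw [abs_neg, neg_neg, abs_of_pos
    (Real.exp_pos _)]) y self_mem_Ici)

/-- The two terms of `gaussTail₃` nearly cancel, which is why a high convergent is needed: `(1 +
y²)(y⁴ + 9y² + 8) - y²(y⁴ + 10y² + 15) = 2(y² + 4)`. -/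
lemma gaussTail₃_le {y : ℝ} (hy : 0 < y) :
    gaussTail₃ y ≤ Real.exp (-y ^ 2 / 2) *
      ((y ^ 2 + 4) / (y ^ 4 + 10 * y ^ 2 + 15)) / y := by
  have h := mul_le_mul_of_nonneg_left (gaussTail_le hy) (show 0 ≤ 1 + y ^ 2 by positivity)
  rw [gaussTail₃]
  have e : Real.exp (-y ^ 2 / 2) * ((y ^ 2 + 4) / (y ^ 4 + 10 * y ^ 2 + 15)) / y =
      ((1 + y ^ 2) * (Real.exp (-y ^ 2 / 2) *
        ((y ^ 4 + 9 * y ^ 2 + 8) / (y ^ 5 + 10 * y ^ 3 + 15 * y)))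
        - y * Real.exp (-y ^ 2 / 2)) / 2 := by
    have : y ^ 5 + 10 * y ^ 3 + 15 * y = y * (y ^ 4 + 10 * y ^ 2 + 15) := by ring
    rw [this]
    field_simp
    ring
  rw [e]
  linarith

lemma gaussTail₃_le_const {y : ℝ} (hy : 0 < y) (hy2 : 3.98 ≤ y ^ 2) :
    gaussTail₃ y ≤ 0.113 / y * Real.exp (-y ^ 2 / 2) := by
  refine (gaussTail₃_le hy).trans ?_
  rw [mul_div_assoc, mul_comm]
  gcongr
  rw [div_le_iff₀ (by positivity)]
  nlinarith

/-- The chain of `∫_y^∞ (z - y)² / 2 e^{-z²} dz`, obtained from `gaussTail₃` by scaling. -/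
lemma decayChain_sqGaussTail₃ (p : ℝ) :
    DecayChain p (fun y => gaussTail₃ (Real.sqrt 2 * y) / (2 * Real.sqrt 2))
      (fun y => (Real.sqrt 2 * y * gaussTail (Real.sqrt 2 * y)
        - Real.exp (-y ^ 2)) / 2)
      (fun y => gaussTail (Real.sqrt 2 * y) / Real.sqrt 2)
      (fun y => -Real.exp (-y ^ 2)) := by
  have h := ((decayChain_gaussTail₃ (Real.sqrt 2 * p)).comp_mul (k := Real.sqrt 2) (r := p)
    (by positivity) le_rfl).const_mul (1 / (2 * Real.sqrt 2))
  have s2 : Real.sqrt 2 ^ 2 = 2 := Real.sq_sqrt (by norm_num)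
  have e : ∀ z : ℝ, -(Real.sqrt 2 * z) ^ 2 / 2 = -z ^ 2 := fun z => by
    rw [mul_pow, s2]; ring
  convert h using 2 with y y y
  · field_simp
  · rw [e]; field_simp
  · field_simp
    rw [s2, mul_comm]
  · rw [e]; field_simp
    rw [s2]

lemma sqGaussTail₃_le {y : ℝ} (hy : 0 < y) (hy2 : 3.98 ≤ y ^ 2) :
    gaussTail₃ (Real.sqrt 2 * y) / (2 * Real.sqrt 2) ≤ 0.01895 / y * Real.exp (-y ^ 2) := by
  have s2 : Real.sqrt 2 ^ 2 = 2 := Real.sq_sqrt (by norm_num)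
  have h := gaussTail₃_le (y := Real.sqrt 2 * y) (by positivity)
  rw [show -(Real.sqrt 2 * y) ^ 2 / 2 = -y ^ 2 by rw [mul_pow, s2]; ring] at h
  have e4 : Real.sqrt 2 ^ 4 = 4 := by
    rw [show Real.sqrt 2 ^ 4 = (Real.sqrt 2 ^ 2) ^ 2 by ring, s2]; norm_num
  rw [mul_pow, mul_pow, s2, e4] at h
  -- The fraction is about `0.0757` at `y² = 3.98`. The prefactors `√2` and `2√2` then turn `0.0758`
  -- into `0.0758 / 4 = 0.01895`.
  have hb : (2 * y ^ 2 + 4) / (4 * y ^ 4 + 10 * (2 * y ^ 2) + 15) ≤ 0.0758 := by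
    rw [div_le_iff₀ (by positivity)]
    nlinarith
  have h' : gaussTail₃ (Real.sqrt 2 * y) ≤ Real.exp (-y ^ 2) * 0.0758 / (Real.sqrt 2 * y) :=
    h.trans (by gcongr)
  rw [div_le_iff₀ (by positivity)]
  refine h'.trans (le_of_eq ?_)
  field_simp
  rw [s2]
  norm_num

end Blasius

namespace Blasius

/-! ### The integral equation `H(y) = E ∫_y^∞ (z - y)² / 2 e^{-z²/2} e^{H(z)} dz` -/

lemma exp_sub_exp_le {a b M : ℝ} (ha : a ≤ M) :
    Real.exp a - Real.exp b ≤ Real.exp M * |a - b| := by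
  have h1 : Real.exp b = Real.exp a * Real.exp (b - a) := by rw [← Real.exp_add]; ring_nf
  have h2 := Real.add_one_le_exp (b - a)
  have h3 : Real.exp a ≤ Real.exp M := Real.exp_le_exp.2 ha
  calc Real.exp a - Real.exp b = Real.exp a * (1 - Real.exp (b - a)) := by rw [h1]; ring
    _ ≤ Real.exp a * |a - b| :=
      mul_le_mul_of_nonneg_left (by linarith [le_abs_self (a - b)]) (Real.exp_pos _).le
    _ ≤ _ := mul_le_mul_of_nonneg_right h3 (abs_nonneg _)

lemma abs_exp_sub_exp_le {a b M : ℝ} (ha : a ≤ M) (hb : b ≤ M) :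
    |Real.exp a - Real.exp b| ≤ Real.exp M * |a - b| := by
  rw [abs_sub_le_iff]
  exact ⟨exp_sub_exp_le ha, abs_sub_comm a b ▸ exp_sub_exp_le hb⟩

lemma abs_exp_min_sub_le (a b : ℝ) :
    |Real.exp (min a 1) - Real.exp (min b 1)| ≤ Real.exp 1 * |a - b| := by
  have h : |min a 1 - min b 1| ≤ |a - b| := by
    simpa using abs_min_sub_min_le_max a 1 b 1
  exact (abs_exp_sub_exp_le (min_le_right _ _) (min_le_right _ _)).trans
    (mul_le_mul_of_nonneg_left h (Real.exp_pos 1).le)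

/-- The truncated right-hand side of the equation, constant to the left of `p` up to the
Gaussian factor. -/
noncomputable def truncSource (E p : ℝ) (u : ℝ → ℝ) (z : ℝ) : ℝ :=
  E * Real.exp (-z ^ 2 / 2) * Real.exp (min (u (max z p)) 1)

section truncSource

variable {E p : ℝ} {u v : ℝ → ℝ}

lemma continuous_truncSource (hu : Continuous u) : Continuous (truncSource E p u) := by
  unfold truncSource
  fun_prop

lemma abs_truncSource_le (z : ℝ) :
    |truncSource E p u z| ≤ |E| * Real.exp (3 / 2) * Real.exp (-z) := by
  have h1 : Real.exp (min (u (max z p)) 1) ≤ Real.exp 1 := Real.exp_le_exp.2 (min_le_right _ _)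
  have e : Real.exp (3 / 2) = Real.exp (1 / 2) * Real.exp 1 := by rw [← Real.exp_add]; norm_num
  rw [truncSource, abs_mul, abs_mul, abs_of_pos (Real.exp_pos _), abs_of_pos (Real.exp_pos _), e]
  calc |E| * Real.exp (-z ^ 2 / 2) * Real.exp (min (u (max z p)) 1)
      ≤ |E| * (Real.exp (1 / 2) * Real.exp (-z)) * Real.exp 1 := by
        gcongr
        exact exp_neg_sq_half_le z
    _ = _ := by ring

lemma abs_truncSource_sub_le {d : ℝ} (hd : ∀ z, |u z - v z| ≤ d) (z : ℝ) :
    |truncSource E p u z - truncSource E p v z| ≤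
      |E| * Real.exp (3 / 2) * d * Real.exp (-z) := by
  have e : Real.exp (3 / 2) = Real.exp (1 / 2) * Real.exp 1 := by rw [← Real.exp_add]; norm_num
  have h := (abs_exp_min_sub_le (u (max z p)) (v (max z p))).trans
    (mul_le_mul_of_nonneg_left (hd (max z p)) (Real.exp_pos 1).le)
  rw [truncSource, truncSource, ← mul_sub, abs_mul, abs_mul, abs_of_pos (Real.exp_pos _), e]
  calc |E| * Real.exp (-z ^ 2 / 2) * |Real.exp (min (u (max z p)) 1)
        - Real.exp (min (v (max z p)) 1)|
      ≤ |E| * (Real.exp (1 / 2) * Real.exp (-z)) * (Real.exp 1 * d) := by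
        gcongr
        exact exp_neg_sq_half_le z
    _ = _ := by ring

/-- The triple tail integral of the truncated source. -/
noncomputable def tripleTail (E p : ℝ) (u : ℝ → ℝ) : ℝ → ℝ :=
  tail (tail (tail (truncSource E p u)))

lemma continuous_tripleTail (hu : Continuous u) : Continuous (tripleTail E p u) := by
  have c := continuous_truncSource (E := E) (p := p) hu
  have b := abs_truncSource_le (E := E) (p := p) (u := u)
  exact continuous_tail (continuous_tail (continuous_tail c b) (abs_tail_le b))
    (abs_tail_le (abs_tail_le b))

lemma abs_tripleTail_le (z : ℝ) :
    |tripleTail E p u z| ≤ |E| * Real.exp (3 / 2) * Real.exp (-z) :=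
  abs_tail_le (abs_tail_le (abs_tail_le abs_truncSource_le)) z

lemma decayChain_tripleTail (hu : Continuous u) (r : ℝ) :
    DecayChain r (tripleTail E p u) (fun y => -tail (tail (truncSource E p u)) y)
      (tail (truncSource E p u)) (fun y => -truncSource E p u y) :=
  decayChain_tail (continuous_truncSource hu) abs_truncSource_le r

lemma abs_tripleTail_sub_le (hu : Continuous u) (hv : Continuous v) {d : ℝ}
    (hd : ∀ z, |u z - v z| ≤ d) (z : ℝ) :
    |tripleTail E p u z - tripleTail E p v z| ≤
      |E| * Real.exp (3 / 2) * d * Real.exp (-z) := by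
  have h := ((decayChain_tripleTail (E := E) (p := p) hu z).sub
    (decayChain_tripleTail (E := E) (p := p) hv z)).abs_le
    ((decayChain_exp 1 one_pos z).const_mul (|E| * Real.exp (3 / 2) * d)) (fun x _ => ?_) z
    self_mem_Ici
  · simpa using h
  · have := abs_truncSource_sub_le (E := E) (p := p) hd x
    rw [neg_sub_neg, abs_sub_comm]
    simpa using this

end truncSource

lemma exp_factor_le_one {p z : ℝ} (hp : 1.99 ≤ p) (hz : p ≤ z) :
    Real.exp (3 / 2) * Real.exp (-z) ≤ 1 := by
  rw [← Real.exp_add]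
  exact Real.exp_le_one_iff.2 (by linarith)

/-- Banach's fixed point theorem on bounded continuous functions on the whole line. The cutoff at
`1` makes the exponential globally Lipschitz with constant `e`, and evaluation at `max z p` discards
everything left of `p`. Since `e^{3/2} e^{-p} ≤ 1`, the contraction constant and the size of the
image are both at most `|E| ≤ 1/2`. -/
theorem exists_decayChain {E p : ℝ} (hE : |E| ≤ 1 / 2) (hp : 1.99 ≤ p) :
    ∃ H H₁ H₂ : ℝ → ℝ,
      DecayChain p H H₁ H₂ (fun z => -(E * Real.exp (-z ^ 2 / 2) * Real.exp (H z))) ∧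
      ∀ z ∈ Ici p, |H z| ≤ 1 / 2 := by
  have key : ∀ z, |E| * Real.exp (3 / 2) * Real.exp (-max z p) ≤ 1 / 2 := fun z => by
    have := exp_factor_le_one hp (le_max_right z p)
    nlinarith [abs_nonneg E]
  let Φ : BoundedContinuousFunction ℝ ℝ → BoundedContinuousFunction ℝ ℝ := fun u =>
    BoundedContinuousFunction.ofNormedAddCommGroup (fun y => tripleTail E p u (max y p))
      ((continuous_tripleTail u.continuous).comp (by fun_prop)) (1 / 2)
      (fun y => (abs_tripleTail_le _).trans (key y))
  have hΦ : ContractingWith (1 / 2) Φ := by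
    refine ⟨by rw [← NNReal.coe_lt_coe]; norm_num, LipschitzWith.of_dist_le_mul fun u v => ?_⟩
    rw [BoundedContinuousFunction.dist_le (by positivity)]
    intro y
    have hd : ∀ z, |u z - v z| ≤ dist u v := fun z => by
      rw [← Real.dist_eq]; exact BoundedContinuousFunction.dist_coe_le_dist z
    rw [Real.dist_eq]
    refine (abs_tripleTail_sub_le u.continuous v.continuous hd _).trans ?_
    have := mul_le_mul_of_nonneg_right (key y) (dist_nonneg (x := u) (y := v))
    push_cast
    linarith
  let u := hΦ.fixedPoint
  have hu : ∀ y, tripleTail E p u (max y p) = u y := fun y =>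
    DFunLike.congr_fun hΦ.fixedPoint_isFixedPt y
  have hb : ∀ z ∈ Ici p, |tripleTail E p u z| ≤ 1 / 2 := fun z hz => by
    have := key z
    rw [max_eq_left hz] at this
    exact (abs_tripleTail_le z).trans this
  refine ⟨_, _, _, (decayChain_tripleTail u.continuous p).congr fun z hz => ?_, hb⟩
  -- On `[p, ∞)` the fixed point is its own triple tail and is at most `1/2 < 1`, so the cutoff is
  -- inactive there.
  have : u (max z p) = tripleTail E p u z := by rw [← hu, max_assoc, max_self, max_eq_left hz]
  simp only [truncSource]
  rw [this, min_eq_left (by linarith [le_abs_self (tripleTail E p u z), hb z hz])]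

end Blasius

namespace Blasius

/-! ### The two leading terms of the expansion in `E` -/

/-- The first two terms of the expansion in powers of `E` of the solution `h` of
`h'' = E e^{-y²/2} exp (∫_y^∞ h)`. -/
noncomputable def quasi (E y : ℝ) : ℝ :=
  E * (Real.exp (-y ^ 2 / 2) - y * gaussTail y) +
    E ^ 2 / 2 * (3 * gaussTail y * Real.exp (-y ^ 2 / 2) - y * gaussTail y ^ 2
      - 2 * Real.sqrt 2 * gaussTail (Real.sqrt 2 * y))

/-- The derivative of `quasi`. -/
noncomputable def quasiDeriv (E y : ℝ) : ℝ :=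
  -E * gaussTail y +
    E ^ 2 / 2 * (Real.exp (-y ^ 2 / 2) ^ 2 - y * gaussTail y * Real.exp (-y ^ 2 / 2)
      - gaussTail y ^ 2)

/-- The second derivative of `quasi`. -/
noncomputable def quasiDeriv₂ (E y : ℝ) : ℝ :=
  E * Real.exp (-y ^ 2 / 2) * (1 + E * gaussTail₃ y)

lemma hasDerivAt_gaussTail_sqrt_two_mul (y : ℝ) :
    HasDerivAt (fun y => gaussTail (Real.sqrt 2 * y))
      (-(Real.sqrt 2 * Real.exp (-y ^ 2 / 2) ^ 2)) y := by
  have h := (hasDerivAt_gaussTail (Real.sqrt 2 * y)).comp y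
    ((hasDerivAt_id y).const_mul (Real.sqrt 2))
  refine h.congr_deriv ?_
  rw [← Real.exp_nat_mul, mul_pow, Real.sq_sqrt (by norm_num)]
  have : -(2 * y ^ 2) / 2 = ((2 : ℕ) : ℝ) * (-y ^ 2 / 2) := by push_cast; ring
  rw [this]
  ring

lemma hasDerivAt_quasi (E y : ℝ) : HasDerivAt (quasi E) (quasiDeriv E y) y := by
  have hw := hasDerivAt_exp_neg_sq_half y
  have hQ := hasDerivAt_gaussTail y
  have hi := hasDerivAt_id y
  have h := ((hw.sub (hi.mul hQ)).const_mul E).add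
    (((((hQ.const_mul 3).mul hw).sub (hi.mul (hQ.pow 2))).sub
      ((hasDerivAt_gaussTail_sqrt_two_mul y).const_mul (2 * Real.sqrt 2))).const_mul (E ^ 2 / 2))
  refine h.congr_deriv ?_
  have s2 : Real.sqrt 2 ^ 2 = 2 := Real.sq_sqrt (by norm_num)
  simp only [id, quasiDeriv, Nat.cast_ofNat, Pi.pow_apply]
  linear_combination (E ^ 2 * Real.exp (-y ^ 2 / 2) ^ 2) * s2

/-- This is what makes `quasi` the right approximation: its second derivative is `E e^{-y²/2} e^H`
with `e^H` replaced by `1 + E gaussTail₃`. -/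
lemma hasDerivAt_quasiDeriv (E y : ℝ) : HasDerivAt (quasiDeriv E) (quasiDeriv₂ E y) y := by
  have hw := hasDerivAt_exp_neg_sq_half y
  have hQ := hasDerivAt_gaussTail y
  have hi := hasDerivAt_id y
  have h := (hQ.const_mul (-E)).add
    ((((hw.pow 2).sub ((hi.mul hQ).mul hw)).sub (hQ.pow 2)).const_mul (E ^ 2 / 2))
  refine h.congr_deriv ?_
  simp only [id, quasiDeriv₂, gaussTail₃, Nat.cast_ofNat, Pi.mul_apply]
  ring

lemma hasDerivAt_quasiDeriv₂ (E y : ℝ) : HasDerivAt (quasiDeriv₂ E)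
    (E * (-(y * Real.exp (-y ^ 2 / 2))) * (1 + E * gaussTail₃ y) +
      E * Real.exp (-y ^ 2 / 2) * (E * (y * gaussTail y - Real.exp (-y ^ 2 / 2)))) y :=
  ((hasDerivAt_exp_neg_sq_half y).const_mul E).mul
    (((hasDerivAt_gaussTail₃ y).const_mul E).const_add 1)

lemma tendsto_quasi (E : ℝ) : Tendsto (quasi E) atTop (𝓝 0) := by
  have hl : Tendsto (fun y : ℝ => Real.sqrt 2 * y) atTop atTop :=
    tendsto_id.const_mul_atTop (by positivity)
  have h := ((tendsto_exp_neg_sq_half.sub (tendsto_pow_mul_gaussTail 1)).const_mul E).add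
    (((((tendsto_gaussTail.const_mul 3).mul tendsto_exp_neg_sq_half).sub
      ((tendsto_pow_mul_gaussTail 1).mul tendsto_gaussTail)).sub
      ((tendsto_gaussTail.comp hl).const_mul (2 * Real.sqrt 2))).const_mul (E ^ 2 / 2))
  simp only [mul_zero, sub_zero, add_zero] at h
  refine h.congr fun y => ?_
  simp only [quasi, Function.comp_apply]
  ring

lemma tendsto_quasiDeriv (E : ℝ) : Tendsto (quasiDeriv E) atTop (𝓝 0) := by
  have h := (tendsto_gaussTail.const_mul (-E)).add
    ((((tendsto_exp_neg_sq_half.pow 2).sub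
      ((tendsto_pow_mul_gaussTail 1).mul tendsto_exp_neg_sq_half)).sub
      (tendsto_gaussTail.pow 2)).const_mul (E ^ 2 / 2))
  simp only [mul_zero, sub_zero, add_zero, ne_eq, OfNat.ofNat_ne_zero, not_false_eq_true,
    zero_pow] at h
  refine h.congr fun y => ?_
  simp only [quasiDeriv, pow_one]

/-! ### Error bounds -/

lemma abs_exp_sub_one_le_of_abs_le_one {x : ℝ} (hx : |x| ≤ 1) :
    |Real.exp x - 1| ≤ |x| * (1 + 3 / 4 * |x|) := by
  have h := Real.exp_bound hx (n := 2) (by norm_num)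
  have e : ∑ m ∈ Finset.range 2, x ^ m / (m.factorial : ℝ) = 1 + x := by
    simp [Finset.sum_range_succ]
  rw [e] at h
  have h2 : |x| ^ 2 * (((Nat.succ 2 : ℕ) : ℝ) / (((Nat.factorial 2 : ℕ) : ℝ) * ((2 : ℕ) : ℝ)))
      = 3 / 4 * |x| ^ 2 := by
    norm_num [Nat.factorial]; ring
  rw [h2] at h
  have := abs_add_le (Real.exp x - (1 + x)) x
  rw [show Real.exp x - (1 + x) + x = Real.exp x - 1 by ring] at this
  nlinarith

lemma abs_exp_sub_one_sub_le {x : ℝ} (hx : |x| ≤ 1) :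
    |Real.exp x - 1 - x| ≤ |x| ^ 2 * (1 / 2 + 2 / 9 * |x|) := by
  have h := Real.exp_bound hx (n := 3) (by norm_num)
  have e : ∑ m ∈ Finset.range 3, x ^ m / (m.factorial : ℝ) = 1 + x + x ^ 2 / 2 := by
    simp [Finset.sum_range_succ]
  rw [e] at h
  have h2 : |x| ^ 3 * (((Nat.succ 3 : ℕ) : ℝ) / (((Nat.factorial 3 : ℕ) : ℝ) * ((3 : ℕ) : ℝ)))
      = 2 / 9 * |x| ^ 3 := by
    norm_num [Nat.factorial]; ring
  rw [h2] at h
  have := abs_add_le (Real.exp x - (1 + x + x ^ 2 / 2)) (x ^ 2 / 2)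
  rw [show Real.exp x - (1 + x + x ^ 2 / 2) + x ^ 2 / 2 = Real.exp x - 1 - x by ring,
    abs_of_nonneg (show 0 ≤ x ^ 2 / 2 by positivity)] at this
  have h3 := sq_abs x
  linarith [show |x| ^ 2 * (1 / 2 + 2 / 9 * |x|) = |x| ^ 2 / 2 + 2 / 9 * |x| ^ 3 by ring]

lemma exp_neg_le_of_le {x : ℝ} (hx : 1.99 ≤ x) : Real.exp (-x) ≤ 0.14 := by
  have h1 : Real.exp (-x) ≤ (Real.exp 1.99)⁻¹ := by
    rw [← Real.exp_neg]; exact Real.exp_le_exp.2 (by linarith)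
  have h2 : (0.14 : ℝ)⁻¹ ≤ Real.exp 1.99 := by
    -- `e^{1.99} = e² e^{-0.01} ≥ 7.29 · 0.99`, which exceeds `1 / 0.14`.
    have e : Real.exp 1.99 = Real.exp 1 * Real.exp 1 * Real.exp (-0.01) := by
      rw [← Real.exp_add, ← Real.exp_add]; norm_num
    have h3 := Real.exp_one_gt_d9
    have h4 := Real.add_one_le_exp (-0.01 : ℝ)
    rw [e]
    have h5 : (7.29 : ℝ) ≤ Real.exp 1 * Real.exp 1 := by nlinarith
    nlinarith
  refine h1.trans ?_
  rw [inv_le_comm₀ (Real.exp_pos _) (by norm_num)]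
  exact h2

/-! ### Estimates for solutions of the integral equation when `y² ≥ 3.98` -/

section bounds

variable {E p : ℝ} {H H₁ H₂ : ℝ → ℝ}

lemma le_of_sq_ge (hp : 0 < p) (hp2 : 3.98 ≤ p ^ 2) : 1.99 ≤ p := by nlinarith

lemma sq_ge_of_mem (hp : 0 < p) (hp2 : 3.98 ≤ p ^ 2) {z : ℝ} (hz : z ∈ Ici p) :
    0 < z ∧ 3.98 ≤ z ^ 2 :=
  ⟨hp.trans_le hz, hp2.trans (pow_le_pow_left₀ hp.le hz 2)⟩

lemma abs_const_le (hE : |E| ≤ Real.sqrt 2 / 4) : |E| ≤ 0.36 := by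
  have : Real.sqrt 2 ≤ 1.44 := Real.sqrt_le_iff.2 ⟨by norm_num, by norm_num⟩
  linarith

lemma gaussTail₃_le_num {z : ℝ} (hz : 0 < z) (hz2 : 3.98 ≤ z ^ 2) : gaussTail₃ z ≤ 0.00796 := by
  have h1 := le_of_sq_ge hz hz2
  have h2 := exp_neg_le_of_le (x := z ^ 2 / 2) (by linarith)
  rw [← neg_div] at h2
  calc gaussTail₃ z ≤ 0.113 / z * Real.exp (-z ^ 2 / 2) := gaussTail₃_le_const hz hz2
    _ ≤ 0.113 / 1.99 * 0.14 := by gcongr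
    _ ≤ _ := by norm_num

lemma abs_le_of_exp_le {K : ℝ}
    (hH : DecayChain p H H₁ H₂ (fun z => -(E * Real.exp (-z ^ 2 / 2) * Real.exp (H z))))
    (hK : ∀ z ∈ Ici p, Real.exp (H z) ≤ K) :
    ∀ z ∈ Ici p, |H z| ≤ K * |E| * gaussTail₃ z := by
  refine hH.abs_le ((decayChain_gaussTail₃ p).const_mul (K * |E|)) fun z hz => ?_
  rw [abs_neg, abs_mul, abs_mul, abs_of_pos (Real.exp_pos _), abs_of_pos (Real.exp_pos _)]
  have := mul_le_mul_of_nonneg_left (hK z hz)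
    (mul_nonneg (abs_nonneg E) (Real.exp_pos (-z ^ 2 / 2)).le)
  linarith

/-- A bootstrap through `abs_le_of_exp_le`: `|H| ≤ 1/2` gives `e^H ≤ 2`, hence `|H| ≤ 0.006`, hence
`e^H ≤ 1.007`. -/
lemma abs_le_gaussTail₃ (hp : 0 < p) (hp2 : 3.98 ≤ p ^ 2) (hE : |E| ≤ Real.sqrt 2 / 4)
    (hH : DecayChain p H H₁ H₂ (fun z => -(E * Real.exp (-z ^ 2 / 2) * Real.exp (H z))))
    (hb : ∀ z ∈ Ici p, |H z| ≤ 1 / 2) :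
    ∀ z ∈ Ici p, |H z| ≤ 1.007 * |E| * gaussTail₃ z := by
  have hE' := abs_const_le hE
  have h1 := abs_le_of_exp_le hH (K := 2) fun z hz => by
    have := abs_exp_sub_one_le_of_abs_le_one ((hb z hz).trans (by norm_num))
    nlinarith [le_abs_self (Real.exp (H z) - 1), hb z hz, abs_nonneg (H z)]
  refine abs_le_of_exp_le hH fun z hz => ?_
  obtain ⟨hz0, hz2⟩ := sq_ge_of_mem hp hp2 hz
  have h2 : |H z| ≤ 0.006 := by
    refine (h1 z hz).trans ?_
    calc 2 * |E| * gaussTail₃ z ≤ 2 * 0.36 * 0.00796 := by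
          gcongr
          · exact gaussTail₃_nonneg z
          · exact gaussTail₃_le_num hz0 hz2
      _ ≤ _ := by norm_num
  have := abs_exp_sub_one_le_of_abs_le_one (h2.trans (by norm_num))
  nlinarith [le_abs_self (Real.exp (H z) - 1), abs_nonneg (H z)]

lemma abs_le_num (hp : 0 < p) (hp2 : 3.98 ≤ p ^ 2) (hE : |E| ≤ Real.sqrt 2 / 4)
    (hb : ∀ z ∈ Ici p, |H z| ≤ 1.007 * |E| * gaussTail₃ z) :
    ∀ z ∈ Ici p, |H z| ≤ 0.0029 := by
  intro z hz
  obtain ⟨hz0, hz2⟩ := sq_ge_of_mem hp hp2 hz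
  have hE' := abs_const_le hE
  refine (hb z hz).trans ?_
  calc 1.007 * |E| * gaussTail₃ z ≤ 1.007 * 0.36 * 0.00796 := by
        gcongr
        · exact gaussTail₃_nonneg z
        · exact gaussTail₃_le_num hz0 hz2
    _ ≤ _ := by norm_num

lemma abs_sub_linear_le (hp : 0 < p) (hp2 : 3.98 ≤ p ^ 2) (hE : |E| ≤ Real.sqrt 2 / 4)
    (hH : DecayChain p H H₁ H₂ (fun z => -(E * Real.exp (-z ^ 2 / 2) * Real.exp (H z))))
    (hb : ∀ z ∈ Ici p, |H z| ≤ 1.007 * |E| * gaussTail₃ z) :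
    ∀ y ∈ Ici p, |H y - E * gaussTail₃ y| ≤
      0.00217 * |E| ^ 2 / y ^ 2 * Real.exp (-y ^ 2 / 2) ^ 2 := by
  intro y hy
  obtain ⟨hy0, hy2⟩ := sq_ge_of_mem hp hp2 hy
  have hn := abs_le_num hp hp2 hE hb
  -- The third derivative of `H - E gaussTail₃` is `-E e^{-z²/2} (e^H - 1)`, of order `E² e^{-z²} /
  -- z`. Restarting the chain at `y` allows `1/z` to be replaced by the constant `1/y`, so that only
  -- `e^{-z²}` has to be integrated three times.
  have key := (((hH.mono hy).sub ((decayChain_gaussTail₃ y).const_mul E)).abs_le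
    ((decayChain_sqGaussTail₃ y).const_mul (1.01 * |E| ^ 2 * (0.113 / y))) ?_) y self_mem_Ici
  · refine key.trans ?_
    have e : Real.exp (-y ^ 2) = Real.exp (-y ^ 2 / 2) ^ 2 := by
      rw [← Real.exp_nat_mul]; congr 1; push_cast; ring
    have h := sqGaussTail₃_le hy0 hy2
    rw [e] at h
    calc _ ≤ 1.01 * |E| ^ 2 * (0.113 / y) * (0.01895 / y * Real.exp (-y ^ 2 / 2) ^ 2) := by
          gcongr
      _ = 0.0021627635 * (|E| ^ 2 / y ^ 2 * Real.exp (-y ^ 2 / 2) ^ 2) := by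
          ring
      _ ≤ 0.00217 * (|E| ^ 2 / y ^ 2 * Real.exp (-y ^ 2 / 2) ^ 2) := by
          gcongr; norm_num
      _ = _ := by ring
  · intro z hz
    have hzp : z ∈ Ici p := le_trans (mem_Ici.1 hy) hz
    obtain ⟨hz0, hz2⟩ := sq_ge_of_mem hp hp2 hzp
    have h1 : |Real.exp (H z) - 1| ≤ 1.01 * |E| * (0.113 / y * Real.exp (-z ^ 2 / 2)) := by
      have h2 := abs_exp_sub_one_le_of_abs_le_one ((hn z hzp).trans (by norm_num))
      have h3 : gaussTail₃ z ≤ 0.113 / y * Real.exp (-z ^ 2 / 2) := by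
        refine (gaussTail₃_le_const hz0 hz2).trans ?_
        have : y ≤ z := hz
        gcongr
      calc |Real.exp (H z) - 1| ≤ |H z| * (1 + 3 / 4 * |H z|) := h2
        _ ≤ (1.007 * |E| * gaussTail₃ z) * (1 + 3 / 4 * 0.0029) := by
          gcongr
          · exact mul_nonneg (by positivity) (gaussTail₃_nonneg z)
          · exact hb z hzp
          · exact hn z hzp
        _ = (1.007 * (1 + 3 / 4 * 0.0029)) * (|E| * gaussTail₃ z) := by ring
        _ ≤ 1.01 * (|E| * (0.113 / y * Real.exp (-z ^ 2 / 2))) := by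
          gcongr
          · exact mul_nonneg (abs_nonneg E) (gaussTail₃_nonneg z)
          · norm_num
        _ = _ := by ring
    have e : Real.exp (-z ^ 2) = Real.exp (-z ^ 2 / 2) * Real.exp (-z ^ 2 / 2) := by
      rw [← Real.exp_add]; ring_nf
    rw [show -(E * Real.exp (-z ^ 2 / 2) * Real.exp (H z)) - E * -Real.exp (-z ^ 2 / 2)
      = -(E * Real.exp (-z ^ 2 / 2) * (Real.exp (H z) - 1)) by ring, abs_neg, abs_mul, abs_mul,
      abs_of_pos (Real.exp_pos _), e]
    calc |E| * Real.exp (-z ^ 2 / 2) * |Real.exp (H z) - 1|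
        ≤ |E| * Real.exp (-z ^ 2 / 2) * (1.01 * |E| * (0.113 / y * Real.exp (-z ^ 2 / 2))) := by
          gcongr
      _ = _ := by ring

lemma abs_error₂_le (hp : 0 < p) (hp2 : 3.98 ≤ p ^ 2) (hE : |E| ≤ Real.sqrt 2 / 4)
    (hH : DecayChain p H H₁ H₂ (fun z => -(E * Real.exp (-z ^ 2 / 2) * Real.exp (H z))))
    (hb : ∀ z ∈ Ici p, |H z| ≤ 1 / 2) :
    ∀ y ∈ Ici p, |E * Real.exp (-y ^ 2 / 2) * Real.exp (H y) - quasiDeriv₂ E y| ≤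
      Real.sqrt 2 * 2.8125e-4 / y ^ 2 * Real.exp (-3 * y ^ 2 / 2) := by
  intro y hy
  obtain ⟨hy0, hy2⟩ := sq_ge_of_mem hp hp2 hy
  have hb' := abs_le_gaussTail₃ hp hp2 hE hH hb
  have hn := abs_le_num hp hp2 hE hb' y hy
  set w := Real.exp (-y ^ 2 / 2) with hw
  have hwp : 0 < w := Real.exp_pos _
  have e : Real.exp (-3 * y ^ 2 / 2) = w ^ 3 := by
    rw [hw, ← Real.exp_nat_mul]; congr 1; push_cast; ring
  have h1 : |H y| ≤ 1.007 * |E| * (0.113 / y * w) :=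
    (hb' y hy).trans (mul_le_mul_of_nonneg_left (gaussTail₃_le_const hy0 hy2) (by positivity))
  have h2 : |Real.exp (H y) - 1 - H y| ≤ 0.0066 * (|E| ^ 2 / y ^ 2 * w ^ 2) := by
    calc |Real.exp (H y) - 1 - H y| ≤ |H y| ^ 2 * (1 / 2 + 2 / 9 * |H y|) :=
          abs_exp_sub_one_sub_le (hn.trans (by norm_num))
      _ ≤ (1.007 * |E| * (0.113 / y * w)) ^ 2 * (1 / 2 + 2 / 9 * 0.0029) := by gcongr
      _ = (1.007 * 0.113) ^ 2 * (1 / 2 + 2 / 9 * 0.0029) * (|E| ^ 2 / y ^ 2 * w ^ 2) := by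
          field_simp
      _ ≤ _ := by gcongr; norm_num
  have h3 := abs_sub_linear_le hp hp2 hE hH hb' y hy
  -- Two quadratic errors add up: the Taylor remainder of `exp` (`0.0066`) and the replacement of
  -- `H` by its linear part (`0.00217`).
  have h4 : |Real.exp (H y) - 1 - E * gaussTail₃ y| ≤ 0.009 * (|E| ^ 2 / y ^ 2 * w ^ 2) := by
    have := abs_add_le (Real.exp (H y) - 1 - H y) (H y - E * gaussTail₃ y)
    rw [show Real.exp (H y) - 1 - H y + (H y - E * gaussTail₃ y)
      = Real.exp (H y) - 1 - E * gaussTail₃ y by ring] at this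
    have h5 : 0 ≤ |E| ^ 2 / y ^ 2 * w ^ 2 := by positivity
    have h6 : 0.00217 * |E| ^ 2 / y ^ 2 * w ^ 2 = 0.00217 * (|E| ^ 2 / y ^ 2 * w ^ 2) := by ring
    rw [h6] at h3
    linarith
  -- `(√2 / 4)³ = √2 / 32`, and `0.009 / 32` is the constant `2.8125e-4`.
  have hE3 : |E| ^ 3 ≤ Real.sqrt 2 / 32 := by
    refine (pow_le_pow_left₀ (abs_nonneg E) hE 3).trans (le_of_eq ?_)
    have s2 : Real.sqrt 2 ^ 2 = 2 := Real.sq_sqrt (by norm_num)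
    linear_combination (Real.sqrt 2 / 64) * s2
  rw [quasiDeriv₂, e, ← hw, show E * w * Real.exp (H y) - E * w * (1 + E * gaussTail₃ y)
    = E * w * (Real.exp (H y) - 1 - E * gaussTail₃ y) by ring, abs_mul, abs_mul, abs_of_pos hwp]
  calc |E| * w * |Real.exp (H y) - 1 - E * gaussTail₃ y|
      ≤ |E| * w * (0.009 * (|E| ^ 2 / y ^ 2 * w ^ 2)) := by gcongr
    _ = |E| ^ 3 * (0.009 / y ^ 2 * w ^ 3) := by ring
    _ ≤ Real.sqrt 2 / 32 * (0.009 / y ^ 2 * w ^ 3) := by gcongr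
    _ = _ := by ring

/-- Integration of a bound `B z⁻ⁿ e^{-3z²/2}` on the derivative. -/
lemma abs_le_of_abs_deriv_le_gaussian (hp : 0 < p) {B : ℝ} (hB : 0 ≤ B) {n : ℕ} {f f' : ℝ → ℝ}
    (hf : ∀ z ∈ Ici p, HasDerivWithinAt f (f' z) (Ici p) z)
    (h : ∀ z ∈ Ici p, |f' z| ≤ B / z ^ n * Real.exp (-3 * z ^ 2 / 2))
    (f0 : Tendsto f atTop (𝓝 0)) :
    ∀ y ∈ Ici p, |f y| ≤ B / 3 / y ^ (n + 1) * Real.exp (-3 * y ^ 2 / 2) := by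
  intro y hy
  have hy0 : 0 < y := hp.trans_le hy
  -- For `z ≥ y` one has `z⁻ⁿ ≤ y⁻⁽ⁿ⁺¹⁾ z`. The extra factor `z` makes the Gaussian integrable in
  -- closed form and yields both the `1/3` and the additional power of `y`.
  have hd : ∀ z, HasDerivAt (fun z => B / 3 / y ^ (n + 1) * Real.exp (-3 * z ^ 2 / 2))
      (-(B / y ^ (n + 1) * (z * Real.exp (-3 * z ^ 2 / 2)))) z := by
    intro z
    have := (((((hasDerivAt_id z).pow 2).const_mul (-3)).div_const 2).exp).const_mul
      (B / 3 / y ^ (n + 1))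
    refine this.congr_deriv ?_
    simp
    ring
  have ht : Tendsto (fun z : ℝ => Real.exp (-3 * z ^ 2 / 2)) atTop (𝓝 0) := by
    have := tendsto_exp_neg_sq_half.pow 3
    rw [zero_pow (by norm_num)] at this
    refine this.congr fun z => ?_
    rw [← Real.exp_nat_mul]; congr 1; push_cast; ring
  have hs : Ici y ⊆ Ici p := Ici_subset_Ici.2 hy
  refine abs_le_of_abs_deriv_le (fun z hz => (hf z (hs hz)).mono hs)
    (fun z _ => (hd z).hasDerivWithinAt) (fun z hz => ?_) f0
    (by simpa using ht.const_mul (B / 3 / y ^ (n + 1))) y self_mem_Ici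
  have hyz : y ≤ z := hz
  refine (h z (hs hz)).trans ?_
  rw [neg_neg, ← mul_assoc]
  refine mul_le_mul_of_nonneg_right ?_ (Real.exp_pos _).le
  calc B / z ^ n ≤ B / y ^ n := by gcongr
    _ = B / y ^ (n + 1) * y := by rw [pow_succ]; field_simp
    _ ≤ B / y ^ (n + 1) * z := by gcongr

end bounds

end Blasius

namespace Blasius

/-! ### Uniqueness -/

lemma exists_abs_le_of_tendsto {f : ℝ → ℝ} {p l : ℝ} (hf : ContinuousOn f (Ici p))
    (hl : Tendsto f atTop (𝓝 l)) : ∃ C, 0 ≤ C ∧ ∀ z ∈ Ici p, |f z| ≤ C := by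
  obtain ⟨Y, hY⟩ := eventually_atTop.1 (hl.abs.eventually_le_const (lt_add_one |l|))
  obtain ⟨C, hC⟩ := isCompact_Icc.exists_bound_of_continuousOn
    (hf.mono (Icc_subset_Ici_self : Icc p Y ⊆ Ici p))
  refine ⟨max C (|l| + 1), le_max_of_le_right (by positivity), fun z hz => ?_⟩
  rcases le_total Y z with h | h
  · exact (hY z h).trans (le_max_right _ _)
  · exact (hC z ⟨hz, h⟩).trans (le_max_left _ _)

lemma eq_of_deriv_eq_zero {f : ℝ → ℝ} {p : ℝ}
    (hf : ∀ z ∈ Ici p, HasDerivWithinAt f 0 (Ici p) z) : ∀ z ∈ Ici p, f z = f p := by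
  intro z hz
  refine constant_of_has_deriv_right_zero (a := p) (b := z)
    (fun x hx => ((hf x hx.1).continuousWithinAt).mono Icc_subset_Ici_self)
    (fun x hx => (hf x hx.1).mono (Ici_subset_Ici.2 hx.1)) z ⟨hz, le_rfl⟩

lemma eq_zero_of_deriv₂_eq_zero {f f' : ℝ → ℝ} {p : ℝ}
    (hf : ∀ z ∈ Ici p, HasDerivWithinAt f (f' z) (Ici p) z)
    (hf' : ∀ z ∈ Ici p, HasDerivWithinAt f' 0 (Ici p) z) (f0 : Tendsto f atTop (𝓝 0)) :
    ∀ z ∈ Ici p, f z = 0 ∧ f' z = 0 := by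
  have h1 := eq_of_deriv_eq_zero hf'
  have h2 := eq_of_deriv_eq_zero (f := fun z => f z - f' p * z) (p := p) fun z hz => by
    have := (hf z hz).sub ((hasDerivAt_id z).const_mul (f' p)).hasDerivWithinAt
    rw [h1 z hz, mul_one, sub_self] at this
    exact this
  -- `f` is affine, so `f (z + 1) - f z` is its slope; this difference tends to zero.
  have hc : f' p = 0 := by
    have ht := (f0.comp (tendsto_atTop_add_const_right atTop 1 tendsto_id)).sub f0
    rw [sub_zero] at ht
    refine tendsto_nhds_unique (tendsto_const_nhds.congr' ?_) ht
    filter_upwards [eventually_ge_atTop p] with z hz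
    have a1 := h2 z hz
    have a2 := h2 (z + 1) (le_trans hz (by linarith))
    simp only [Function.comp_apply, id] at *
    linarith
  intro z hz
  refine ⟨?_, (h1 z hz).trans hc⟩
  simp only [hc, zero_mul, sub_zero] at h2
  have hp : f p = 0 := by
    refine tendsto_nhds_unique (tendsto_const_nhds.congr' ?_) f0
    filter_upwards [eventually_ge_atTop p] with x hx
    exact (h2 x hx).symm
  rw [h2 z hz, hp]

section

variable {E p : ℝ} {H H₁ H₂ : ℝ → ℝ}

lemma DecayChain.continuousOn {f₀ f₁ f₂ f₃ : ℝ → ℝ} (hf : DecayChain p f₀ f₁ f₂ f₃) :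
    ContinuousOn f₀ (Ici p) := fun z hz => (hf.d₀ z hz).continuousWithinAt

/-- L'Hôpital's rule twice: the quotient of the second derivatives is `E e^H / (1 + 3/y² + 6/y⁴)`,
and `H` tends to zero. -/
lemma tendsto_leading
    (hH : DecayChain p H H₁ H₂ (fun z => -(E * Real.exp (-z ^ 2 / 2) * Real.exp (H z)))) :
    Tendsto (fun y => -H₁ y / (Real.exp (-y ^ 2 / 2) / y ^ 2)) atTop (𝓝 E) := by
  have hinv : ∀ n : ℕ, n ≠ 0 → Tendsto (fun y : ℝ => 1 / y ^ n) atTop (𝓝 0) := fun n hn =>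
    (tendsto_pow_atTop hn).const_div_atTop 1
  have hg1 : ∀ y : ℝ, 0 < y → HasDerivAt (fun y : ℝ => Real.exp (-y ^ 2 / 2) / y ^ 2)
      (-(2 / y ^ 3 + 1 / y) * Real.exp (-y ^ 2 / 2)) y := by
    intro y hy
    have := (hasDerivAt_exp_neg_sq_half y).div ((hasDerivAt_id y).pow 2) (by simpa using hy.ne')
    refine this.congr_deriv ?_
    simp
    field_simp
    ring
  have hg2 : ∀ y : ℝ, 0 < y → HasDerivAt
      (fun y : ℝ => -(2 / y ^ 3 + 1 / y) * Real.exp (-y ^ 2 / 2))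
      ((1 + 3 / y ^ 2 + 6 / y ^ 4) * Real.exp (-y ^ 2 / 2)) y := by
    intro y hy
    have h3 := (hasDerivAt_const y (2 : ℝ)).div ((hasDerivAt_id y).pow 3) (by simpa using hy.ne')
    have h1 := (hasDerivAt_const y (1 : ℝ)).div (hasDerivAt_id y) hy.ne'
    have := (h3.add h1).neg.mul (hasDerivAt_exp_neg_sq_half y)
    refine this.congr_deriv ?_
    simp
    field_simp
    ring
  have d {f₀ f₁ : ℝ → ℝ} (h : ∀ z ∈ Ici p, HasDerivWithinAt f₀ (f₁ z) (Ici p) z) :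
      ∀ᶠ z in atTop, HasDerivAt (fun z => -f₀ z) (-f₁ z) z := by
    filter_upwards [eventually_gt_atTop p] with z hz
    exact ((h z hz.le).hasDerivAt (Ici_mem_nhds hz)).neg
  have pos := eventually_gt_atTop (0 : ℝ)
  have t1 : Tendsto (fun y : ℝ => -(2 / y ^ 3 + 1 / y) * Real.exp (-y ^ 2 / 2)) atTop (𝓝 0) := by
    have := ((((hinv 3 (by norm_num)).const_mul 2).add (hinv 1 (by norm_num))).neg).mul
      tendsto_exp_neg_sq_half
    simp only [mul_zero, add_zero] at this
    refine this.congr fun y => ?_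
    rw [pow_one, mul_one_div]
  have t0 : Tendsto (fun y : ℝ => Real.exp (-y ^ 2 / 2) / y ^ 2) atTop (𝓝 0) := by
    have := tendsto_exp_neg_sq_half.mul (hinv 2 (by norm_num))
    simp only [mul_zero] at this
    refine this.congr fun y => ?_
    rw [mul_one_div]
  refine HasDerivAt.lhopital_zero_atTop (d hH.d₁) (pos.mono hg1) ?_ (by simpa using hH.t₁.neg) t0 ?_
  · filter_upwards [pos] with y hy
    have : 0 < (2 / y ^ 3 + 1 / y) * Real.exp (-y ^ 2 / 2) := by positivity
    linarith
  refine HasDerivAt.lhopital_zero_atTop (d hH.d₂) (pos.mono hg2) ?_ (by simpa using hH.t₂.neg) t1 ?_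
  · filter_upwards [pos] with y hy
    positivity
  have hl : Tendsto (fun y => E * Real.exp (H y) / (1 + 3 * (1 / y ^ 2) + 6 * (1 / y ^ 4))) atTop
      (𝓝 (E * Real.exp 0 / (1 + 3 * 0 + 6 * 0))) :=
    (hH.t₀.rexp.const_mul E).div ((tendsto_const_nhds.add
      ((hinv 2 (by norm_num)).const_mul 3)).add ((hinv 4 (by norm_num)).const_mul 6)) (by norm_num)
  simp only [Real.exp_zero, mul_one, mul_zero, add_zero, div_one] at hl
  refine hl.congr fun y => ?_
  have := (Real.exp_pos (-y ^ 2 / 2)).ne'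
  rw [neg_neg, mul_one_div, mul_one_div, mul_right_comm, mul_div_mul_right _ _ this]

/-- Picard iteration from infinity: feeding a bound for `D₀` into the hypothesis and integrating
three times improves it to `S Kⁿ / n! · e^{-nz}` for every `n`, which tends to zero. -/
lemma DecayChain.eqOn_zero {D₀ D₁ D₂ D₃ : ℝ → ℝ} (hD : DecayChain p D₀ D₁ D₂ D₃) {K : ℝ}
    (hK : 0 ≤ K) (h : ∀ z ∈ Ici p, |D₃ z| ≤ K * Real.exp (-z) * |D₀ z|) :
    ∀ z ∈ Ici p, D₀ z = 0 := by
  obtain ⟨S, hS, hb⟩ := exists_abs_le_of_tendsto hD.continuousOn hD.t₀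
  have key : ∀ n : ℕ, ∀ z ∈ Ici p,
      |D₀ z| ≤ S * K ^ n / n.factorial * Real.exp (-(n * z)) := by
    intro n
    induction n with
    | zero => intro z hz; simpa using hb z hz
    | succ n ih =>
      -- Three integrations of `e^{-(n+1)z}` gain `(n+1)⁻³`; a single factor suffices to build the
      -- factorial.
      refine hD.abs_le ((decayChain_exp ((n + 1 : ℕ) : ℝ) (by positivity) p).const_mul
        (S * K ^ (n + 1) / (n + 1).factorial)) fun z hz => ?_
      have e : Real.exp (-(((n + 1 : ℕ) : ℝ) * z)) = Real.exp (-z) * Real.exp (-(n * z)) := by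
        rw [← Real.exp_add]; push_cast; ring_nf
      calc |D₃ z| ≤ K * Real.exp (-z) * (S * K ^ n / n.factorial * Real.exp (-(n * z))) :=
            (h z hz).trans (mul_le_mul_of_nonneg_left (ih z hz) (by positivity))
        _ = S * K ^ (n + 1) / (n + 1).factorial * ((n + 1 : ℕ) : ℝ) ^ 1 *
            (Real.exp (-z) * Real.exp (-(n * z))) := by
          rw [Nat.factorial_succ, pow_succ K]; push_cast; field_simp
        _ ≤ S * K ^ (n + 1) / (n + 1).factorial * ((n + 1 : ℕ) : ℝ) ^ 3 *
            (Real.exp (-z) * Real.exp (-(n * z))) := by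
          gcongr
          · exact_mod_cast Nat.le_add_left 1 n
          · norm_num
        _ = _ := by rw [e]; ring
  intro z hz
  have hl := (FloorSemiring.tendsto_pow_div_factorial_atTop (K * Real.exp (-z))).const_mul S
  rw [mul_zero] at hl
  refine abs_nonpos_iff.1 (ge_of_tendsto' hl fun n => (key n z hz).trans (le_of_eq ?_))
  rw [mul_pow, ← Real.exp_nat_mul, mul_neg]
  ring

theorem eqOn_of_decayChain {G G₁ G₂ : ℝ → ℝ}
    (hH : DecayChain p H H₁ H₂ (fun z => -(E * Real.exp (-z ^ 2 / 2) * Real.exp (H z))))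
    (hG : DecayChain p G G₁ G₂ (fun z => -(E * Real.exp (-z ^ 2 / 2) * Real.exp (G z)))) :
    EqOn H₁ G₁ (Ici p) := by
  obtain ⟨M, hM, hb⟩ := exists_abs_le_of_tendsto hH.continuousOn hH.t₀
  obtain ⟨N, hN, hc⟩ := exists_abs_le_of_tendsto hG.continuousOn hG.t₀
  have h0 := (hH.sub hG).eqOn_zero (K := |E| * Real.exp (1 / 2) * Real.exp (max M N))
    (by positivity) fun z hz => by
      have h1 : |Real.exp (H z) - Real.exp (G z)| ≤ Real.exp (max M N) * |H z - G z| :=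
        abs_exp_sub_exp_le ((le_abs_self _).trans ((hb z hz).trans (le_max_left _ _)))
          ((le_abs_self _).trans ((hc z hz).trans (le_max_right _ _)))
      rw [neg_sub_neg, ← mul_sub, abs_mul, abs_mul, abs_of_pos (Real.exp_pos (-z ^ 2 / 2)),
        abs_sub_comm]
      calc |E| * Real.exp (-z ^ 2 / 2) * |Real.exp (H z) - Real.exp (G z)|
          ≤ |E| * (Real.exp (1 / 2) * Real.exp (-z)) *
            (Real.exp (max M N) * |H z - G z|) := by
            gcongr
            exact exp_neg_sq_half_le z
        _ = _ := by ring
  intro z hz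
  have hz' : HasDerivWithinAt H (G₁ z) (Ici p) z :=
    (hG.d₀ z hz).congr (fun x hx => sub_eq_zero.1 (h0 x hx)) (sub_eq_zero.1 (h0 z hz))
  exact (uniqueDiffOn_Ici p z hz).eq_deriv _ (hH.d₀ z hz) hz'

/-- A decaying solution of `h''' + (y + h) h'' = 0` with leading behaviour
`h ~ E e^{-y²/2} / y²` comes from a solution of the integral equation. -/
theorem exists_decayChain_of_solution {h₀ h₁ h₂ : ℝ → ℝ}
    (d₀ : ∀ z ∈ Ici p, HasDerivWithinAt h₀ (h₁ z) (Ici p) z)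
    (d₁ : ∀ z ∈ Ici p, HasDerivWithinAt h₁ (h₂ z) (Ici p) z)
    (d₂ : ∀ z ∈ Ici p, HasDerivWithinAt h₂ (-(z + h₀ z) * h₂ z) (Ici p) z)
    (hl : Tendsto (fun y => h₀ y / (Real.exp (-y ^ 2 / 2) / y ^ 2)) atTop (𝓝 E)) :
    ∃ H H₂ : ℝ → ℝ, DecayChain p H (fun z => -h₀ z) H₂
      (fun z => -(E * Real.exp (-z ^ 2 / 2) * Real.exp (H z))) := by
  -- The leading asymptotics force exponential decay of `h₀`, so its tail integral `H` exists.
  have hbd : ∃ C, ∀ z : ℝ, |h₀ (max z p)| ≤ C * Real.exp (-z) := by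
    have ht : Tendsto (fun y => h₀ y * Real.exp y) atTop (𝓝 0) := by
      have h1 : Tendsto (fun y : ℝ => Real.exp (1 / 2) * (1 / y ^ 2)) atTop (𝓝 0) := by
        simpa using ((tendsto_pow_atTop two_ne_zero).const_div_atTop (1 : ℝ)).const_mul
          (Real.exp (1 / 2))
      have h2 : Tendsto (fun y : ℝ => Real.exp (-y ^ 2 / 2) / y ^ 2 * Real.exp y) atTop
          (𝓝 0) := by
        refine squeeze_zero (fun y => by positivity) (fun y => ?_) h1
        have := mul_le_mul_of_nonneg_right (exp_neg_sq_half_le y) (Real.exp_pos y).le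
        rw [mul_assoc, ← Real.exp_add (-y), neg_add_cancel, Real.exp_zero, mul_one] at this
        calc _ = Real.exp (-y ^ 2 / 2) * Real.exp y * (1 / y ^ 2) := by ring
          _ ≤ _ := by gcongr
      have h3 := hl.mul h2
      rw [mul_zero] at h3
      refine h3.congr' ?_
      filter_upwards [eventually_gt_atTop 0] with y hy
      field_simp
    have hc : ContinuousOn (fun y => h₀ y * Real.exp y) (Ici p) := fun z hz =>
      (d₀ z hz).continuousWithinAt.mul Real.continuous_exp.continuousWithinAt
    obtain ⟨C, hC, hb⟩ := exists_abs_le_of_tendsto hc ht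
    refine ⟨C, fun z => ?_⟩
    have h1 := hb (max z p) (le_max_right z p)
    rw [abs_mul, abs_of_pos (Real.exp_pos _)] at h1
    have h2 : |h₀ (max z p)| * Real.exp z ≤ C :=
      le_trans (by gcongr; exact le_max_left z p) h1
    rw [Real.exp_neg, ← div_eq_mul_inv, le_div_iff₀ (Real.exp_pos z)]
    exact h2
  obtain ⟨C, hC⟩ := hbd
  have hm : Continuous fun z => h₀ (max z p) := by
    have : ContinuousOn h₀ (Ici p) := fun z hz => (d₀ z hz).continuousWithinAt
    exact this.comp_continuous (by fun_prop) fun z => le_max_right z p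
  set H := tail fun z => h₀ (max z p) with hHdef
  have hH0 : ∀ z ∈ Ici p, HasDerivWithinAt H (-h₀ z) (Ici p) z := fun z hz => by
    have := (hasDerivAt_tail hm hC z).hasDerivWithinAt (s := Ici p)
    rwa [max_eq_left (mem_Ici.1 hz)] at this
  have htH : Tendsto H atTop (𝓝 0) := tendsto_zero_of_exp_bound (abs_tail_le hC)
  have hcH : Continuous H := continuous_tail hm hC
  obtain ⟨M, hM, hMb⟩ := exists_abs_le_of_tendsto (p := p) hcH.continuousOn htH
  have hexp : ∀ z ∈ Ici p, HasDerivWithinAt (fun z => Real.exp (z ^ 2 / 2 - H z))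
      (Real.exp (z ^ 2 / 2 - H z) * (z + h₀ z)) (Ici p) z := fun z hz => by
    have := ((((hasDerivAt_id z).pow 2).div_const 2).hasDerivWithinAt.sub (hH0 z hz)).exp
    refine this.congr_deriv ?_
    simp
  -- `e^{z²/2 - H}` is an integrating factor for the linear equation satisfied by `h₂`.
  have hconst := eq_of_deriv_eq_zero (p := p)
    (f := fun z => h₂ z * Real.exp (z ^ 2 / 2 - H z)) fun z hz => by
      refine ((d₂ z hz).mul (hexp z hz)).congr_deriv ?_
      ring
  set B := h₂ p * Real.exp (p ^ 2 / 2 - H p)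
  have hh₂ : ∀ z ∈ Ici p, h₂ z = B * Real.exp (-z ^ 2 / 2) * Real.exp (H z) := fun z hz => by
    rw [← hconst z hz, mul_assoc, mul_assoc, ← Real.exp_add, ← Real.exp_add]
    ring_nf
    simp
  set s : ℝ → ℝ := fun z => B * Real.exp (-z ^ 2 / 2) * Real.exp (H (max z p)) with hs
  have hsc : Continuous s := by fun_prop
  have hsb : ∀ z, |s z| ≤ |B| * Real.exp (1 / 2) * Real.exp M * Real.exp (-z) := fun z => by
    have h1 := (le_abs_self _).trans (hMb (max z p) (le_max_right z p))
    rw [hs, abs_mul, abs_mul, abs_of_pos (Real.exp_pos _), abs_of_pos (Real.exp_pos _)]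
    calc |B| * Real.exp (-z ^ 2 / 2) * Real.exp (H (max z p))
        ≤ |B| * (Real.exp (1 / 2) * Real.exp (-z)) * Real.exp M := by
          gcongr
          exact exp_neg_sq_half_le z
      _ = _ := by ring
  have hse : ∀ z ∈ Ici p, s z = h₂ z := fun z hz => by
    simp only [hs, hh₂ z hz, max_eq_left (mem_Ici.1 hz)]
  have c1 := continuous_tail hsc hsb
  have b1 := abs_tail_le hsb
  have b2 := abs_tail_le b1
  have ht₀ : Tendsto h₀ atTop (𝓝 0) := by
    refine (tendsto_zero_of_exp_bound hC).congr' ?_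
    filter_upwards [eventually_ge_atTop p] with z hz
    rw [max_eq_left hz]
  -- `h₀` and the double tail of its second derivative differ by an affine function vanishing at
  -- infinity, hence agree. In particular `h₁` tends to zero, which was not assumed.
  have hzero := eq_zero_of_deriv₂_eq_zero (p := p) (f := fun z => h₀ z - tail (tail s) z)
    (f' := fun z => h₁ z - -tail s z)
    (fun z hz => (d₀ z hz).sub (hasDerivAt_tail c1 b1 z).hasDerivWithinAt)
    (fun z hz => by
      have := (d₁ z hz).sub (hasDerivAt_tail hsc hsb z).neg.hasDerivWithinAt
      rw [hse z hz, neg_neg, sub_self] at this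
      exact this)
    (by simpa using ht₀.sub (tendsto_zero_of_exp_bound b2))
  have ht₁ : Tendsto h₁ atTop (𝓝 0) := by
    have := (tendsto_zero_of_exp_bound b1).neg
    rw [neg_zero] at this
    refine this.congr' ?_
    filter_upwards [eventually_ge_atTop p] with z hz
    exact (sub_eq_zero.1 (hzero z hz).2).symm
  have chain : DecayChain p H (fun z => -h₀ z) (fun z => -h₁ z)
      (fun z => -(B * Real.exp (-z ^ 2 / 2) * Real.exp (H z))) :=
    ⟨hH0, fun z hz => (d₀ z hz).neg, fun z hz => by rw [← hh₂ z hz]; exact (d₁ z hz).neg,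
      htH, by simpa using ht₀.neg, by simpa using ht₁.neg⟩
  -- A chain with constant `B` has leading coefficient `B`, and limits are unique.
  have hB : B = E := by
    have := tendsto_leading chain
    simp only [neg_neg] at this
    exact tendsto_nhds_unique this hl
  rw [hB] at chain
  exact ⟨_, _, chain⟩

end

end Blasius

namespace Blasius

/-! ### The variables `x`, `t` and `y = √(2t) = √a (x + b/a)` -/

/-- `y = √a (x + b/a)`. -/
noncomputable def yVar (a b x : ℝ) : ℝ := Real.sqrt a * (x + b / a)

/-- The inverse of `yVar`. -/
noncomputable def xVar (a b y : ℝ) : ℝ := y / Real.sqrt a - b / a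

section change_of_variables

variable {a b c T : ℝ}

lemma yVar_xVar (ha : 0 < a) (y : ℝ) : yVar a b (xVar a b y) = y := by
  have : 0 < Real.sqrt a := Real.sqrt_pos.2 ha
  rw [yVar, xVar]
  field_simp
  ring

lemma xVar_mono (ha : 0 < a) : Monotone (xVar a b) := fun y z h => by
  have : 0 < Real.sqrt a := Real.sqrt_pos.2 ha
  rw [xVar, xVar]
  gcongr

lemma yVar_mono (a b : ℝ) : Monotone (yVar a b) := fun y z h => by
  rw [yVar, yVar]
  gcongr

lemma xVar_sqrt (ha : 0 < a) : xVar a b (Real.sqrt (2 * T)) = -b / a + Real.sqrt (2 * T / a) := by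
  rw [xVar, Real.sqrt_div' _ ha.le]
  ring

lemma xDomain_eq (ha : 0 < a) : xDomain a b T = Ici (xVar a b (Real.sqrt (2 * T))) := by
  rw [xDomain, xVar_sqrt ha]

lemma mapsTo_xVar (ha : 0 < a) :
    MapsTo (xVar a b) (Ici (Real.sqrt (2 * T))) (xDomain a b T) := fun y hy => by
  rw [xDomain_eq ha]
  exact xVar_mono ha hy

lemma mapsTo_yVar (ha : 0 < a) :
    MapsTo (yVar a b) (xDomain a b T) (Ici (Real.sqrt (2 * T))) := fun x hx => by
  rw [xDomain_eq ha] at hx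
  have := yVar_mono a b hx
  rwa [yVar_xVar ha] at this

lemma tVar_eq (ha : 0 < a) (x : ℝ) : tVar a b x = yVar a b x ^ 2 / 2 := by
  rw [tVar, yVar, mul_pow, Real.sq_sqrt ha.le]
  ring

lemma linear_eq (ha : 0 < a) (x : ℝ) : a * x + b = Real.sqrt a * yVar a b x := by
  rw [yVar, ← mul_assoc, Real.mul_self_sqrt ha.le]
  field_simp

lemma sqrt_form_eq (ha : 0 < a) {x : ℝ} (hx : 0 < yVar a b x) :
    Real.sqrt (a / (2 * tVar a b x)) = Real.sqrt a / yVar a b x := by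
  rw [tVar_eq ha, Real.sqrt_div ha.le, show 2 * (yVar a b x ^ 2 / 2) = yVar a b x ^ 2 by ring,
    Real.sqrt_sq hx.le]

lemma hasDerivWithinAt_yVar (a b x : ℝ) (s : Set ℝ) :
    HasDerivWithinAt (yVar a b) (Real.sqrt a) s x := by
  have := (((hasDerivAt_id x).add_const (b / a)).const_mul (Real.sqrt a)).hasDerivWithinAt (s := s)
  rwa [mul_one] at this

lemma hasDerivWithinAt_xVar (a b y : ℝ) (s : Set ℝ) :
    HasDerivWithinAt (xVar a b) (1 / Real.sqrt a) s y :=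
  (((hasDerivAt_id y).div_const (Real.sqrt a)).sub_const (b / a)).hasDerivWithinAt

lemma sqrt_two_mul_mem {t : ℝ} (ht : t ∈ Ici T) :
    Real.sqrt (2 * t) ∈ Ici (Real.sqrt (2 * T)) :=
  Real.sqrt_le_sqrt (mul_le_mul_of_nonneg_left ht zero_le_two)

lemma tendsto_sqrt_two_mul : Tendsto (fun t : ℝ => Real.sqrt (2 * t)) atTop atTop :=
  Real.tendsto_sqrt_atTop.comp (tendsto_id.const_mul_atTop zero_lt_two)

lemma tendsto_sq_half : Tendsto (fun y : ℝ => y ^ 2 / 2) atTop atTop :=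
  (tendsto_pow_atTop two_ne_zero).atTop_div_const zero_lt_two

lemma hasDerivAt_sqrt_two_mul {t : ℝ} (ht : 0 < t) :
    HasDerivAt (fun t : ℝ => Real.sqrt (2 * t)) (1 / Real.sqrt (2 * t)) t := by
  refine (((hasDerivAt_id t).const_mul 2).sqrt (by simpa using ht.ne')).congr_deriv ?_
  simp only [id]
  field_simp

/-! ### The quasi-solution in the variable `y` -/

lemma gaussTail_eq_erfc (s : ℝ) :
    Real.sqrt Real.pi * erfc s = Real.sqrt 2 * gaussTail (Real.sqrt 2 * s) := by
  have hpi : 0 < Real.sqrt Real.pi := Real.sqrt_pos.2 Real.pi_pos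
  have s2 : Real.sqrt 2 * Real.sqrt 2 = 2 := Real.mul_self_sqrt (by norm_num)
  have e : Real.sqrt 2 * s / Real.sqrt 2 = s := by field_simp
  rw [erfc, gaussTail, e, tail, ← mul_assoc (Real.sqrt 2), s2]
  field_simp

lemma I₀_eq {y : ℝ} (hy : 0 < y) :
    I₀ (y ^ 2 / 2) = 1 - y * gaussTail y / Real.exp (-y ^ 2 / 2) := by
  have h2 : 0 < Real.sqrt 2 := by positivity
  have hs : Real.sqrt (y ^ 2 / 2) = y / Real.sqrt 2 := by
    rw [Real.sqrt_div (sq_nonneg y), Real.sqrt_sq hy.le]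
  have h := gaussTail_eq_erfc (y / Real.sqrt 2)
  rw [mul_div_cancel₀ _ h2.ne'] at h
  have e : Real.exp (y ^ 2 / 2) = (Real.exp (-y ^ 2 / 2))⁻¹ := by
    rw [← Real.exp_neg]; ring_nf
  rw [I₀, Real.sqrt_mul Real.pi_pos.le, hs, e]
  calc _ = 1 - y / Real.sqrt 2 * (Real.exp (-y ^ 2 / 2))⁻¹ *
        (Real.sqrt Real.pi * erfc (y / Real.sqrt 2)) := by ring
    _ = _ := by rw [h]; field_simp

lemma J₀_eq (t : ℝ) : J₀ t = I₀ (2 * t) := by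
  rw [J₀, I₀]
  ring_nf

/-- The link between the stated `q₀` and the expansion in `E`: with `t = y²/2`, the factor `e^{-t} /
√t` is `√2 e^{-y²/2} / y`, which accounts for `E = √2 c`. -/
lemma q₀_eq (c : ℝ) {y : ℝ} (hy : 0 < y) :
    q₀ c (y ^ 2 / 2) = y * quasi (Real.sqrt 2 * c) y := by
  have s2 : Real.sqrt 2 ^ 2 = 2 := Real.sq_sqrt (by norm_num)
  have h2 : 0 < Real.sqrt 2 := by positivity
  have hs : Real.sqrt (y ^ 2 / 2) = y / Real.sqrt 2 := by
    rw [Real.sqrt_div (sq_nonneg y), Real.sqrt_sq hy.le]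
  have hJ : J₀ (y ^ 2 / 2) = 1 - Real.sqrt 2 * y * gaussTail (Real.sqrt 2 * y) /
      Real.exp (-y ^ 2 / 2) ^ 2 := by
    rw [J₀_eq, show 2 * (y ^ 2 / 2) = (Real.sqrt 2 * y) ^ 2 / 2 by rw [mul_pow, s2]; ring,
      I₀_eq (by positivity), ← Real.exp_nat_mul, mul_pow, s2]
    congr 3
    push_cast
    ring
  have e1 : Real.exp (-(y ^ 2 / 2)) = Real.exp (-y ^ 2 / 2) := by ring_nf
  have e2 : Real.exp (-2 * (y ^ 2 / 2)) = Real.exp (-y ^ 2 / 2) ^ 2 := by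
    rw [← Real.exp_nat_mul]; congr 1; push_cast; ring
  rw [q₀, hJ, I₀_eq hy, hs, e1, e2, quasi]
  have hw := Real.exp_pos (-y ^ 2 / 2)
  set w := Real.exp (-y ^ 2 / 2)
  set Q := gaussTail y
  set R := gaussTail (Real.sqrt 2 * y)
  have a1 : 2 * c * (y / Real.sqrt 2) * w * (1 - y * Q / w) =
      y * (Real.sqrt 2 * c * (w - y * Q)) := by
    field_simp
    rw [s2]
    ring
  have a2 : c ^ 2 * w ^ 2 * (2 * (1 - Real.sqrt 2 * y * R / w ^ 2) - (1 - y * Q / w) -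
      (1 - y * Q / w) ^ 2) =
      y * ((Real.sqrt 2 * c) ^ 2 / 2 * (3 * Q * w - y * Q ^ 2 - 2 * Real.sqrt 2 * R)) := by
    rw [mul_pow, s2]
    field_simp
    ring
  rw [a1, a2]
  ring

end change_of_variables

/-! ### Error bounds in the variable `t` -/

lemma rpow_three_halves {y : ℝ} (hy : 0 < y) :
    (y ^ 2 / 2) ^ (3 / 2 : ℝ) = y ^ 3 / (2 * Real.sqrt 2) := by
  have h : (0 : ℝ) < y ^ 2 / 2 := by positivity
  have s2 : Real.sqrt 2 ^ 2 = 2 := Real.sq_sqrt (by norm_num)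
  rw [show (3 / 2 : ℝ) = 1 + 1 / 2 by norm_num, Real.rpow_add h, Real.rpow_one,
    ← Real.sqrt_eq_rpow, Real.sqrt_div (sq_nonneg y), Real.sqrt_sq hy.le]
  field_simp

/-- After the change of variables the available constant is `2 · 1.6667e-4 = 3.3334e-4`, against
`2.8125e-4`. The slack pays for the lower-order terms in the third bound, a factor `1 + 1/(3y²) +
1/(9y⁴) < 1.1` since `y² ≥ 3.98`. -/
lemma bounds_of_bounds {y e₀ e₁ e₂ G : ℝ} (hy : 0 < y) (hy2 : 3.98 ≤ y ^ 2) (hG : 0 < G)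
    (h₀ : |e₀| ≤ Real.sqrt 2 * 2.8125e-4 / 3 / 3 / y ^ 4 * G)
    (h₁ : |e₁| ≤ Real.sqrt 2 * 2.8125e-4 / 3 / y ^ 3 * G)
    (h₂ : |e₂| ≤ Real.sqrt 2 * 2.8125e-4 / y ^ 2 * G) :
    |y * e₀| ≤ 1.6667e-4 * (G / (9 * (y ^ 3 / (2 * Real.sqrt 2)))) ∧
    |e₁| ≤ 1.6667e-4 * (G / (3 * (y ^ 3 / (2 * Real.sqrt 2)))) ∧
    |(e₂ - e₁ / y - e₀ / y ^ 2) / Real.sqrt 2| ≤ 1.6667e-4 * ((y ^ 2 / 2)⁻¹ * G) ∧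
    |e₂ / Real.sqrt 2| ≤ 1.6667e-4 * ((y ^ 2 / 2)⁻¹ * G) := by
  have hs : 0 < Real.sqrt 2 := by positivity
  refine ⟨?_, ?_, ?_, ?_⟩
  · rw [abs_mul, abs_of_pos hy]
    calc y * |e₀| ≤ y * (Real.sqrt 2 * 2.8125e-4 / 3 / 3 / y ^ 4 * G) := by gcongr
      _ = 2.8125e-4 / 9 * (Real.sqrt 2 * G / y ^ 3) := by field_simp; norm_num
      _ ≤ 1.6667e-4 * 2 / 9 * (Real.sqrt 2 * G / y ^ 3) := by gcongr; norm_num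
      _ = _ := by field_simp
  · calc |e₁| ≤ Real.sqrt 2 * 2.8125e-4 / 3 / y ^ 3 * G := h₁
      _ = 2.8125e-4 / 3 * (Real.sqrt 2 * G / y ^ 3) := by field_simp
      _ ≤ 1.6667e-4 * 2 / 3 * (Real.sqrt 2 * G / y ^ 3) := by gcongr; norm_num
      _ = _ := by field_simp
  · rw [abs_div, abs_of_pos hs, div_le_iff₀ hs]
    have h3 : |e₂ - e₁ / y - e₀ / y ^ 2| ≤ |e₂| + |e₁| / y + |e₀| / y ^ 2 := by
      refine (abs_sub _ _).trans ?_
      rw [abs_div, abs_of_pos (show 0 < y ^ 2 by positivity)]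
      have := abs_sub e₂ (e₁ / y)
      rw [abs_div, abs_of_pos hy] at this
      linarith
    have h4 : 1 / y ^ 2 ≤ 1 / 3.98 := by gcongr
    have h5 : 1 / y ^ 2 * (1 / y ^ 2) ≤ 1 / 3.98 * (1 / 3.98) := by gcongr
    calc _ ≤ |e₂| + |e₁| / y + |e₀| / y ^ 2 := h3
      _ ≤ Real.sqrt 2 * 2.8125e-4 / y ^ 2 * G + Real.sqrt 2 * 2.8125e-4 / 3 / y ^ 3 * G / y +
          Real.sqrt 2 * 2.8125e-4 / 3 / 3 / y ^ 4 * G / y ^ 2 := by gcongr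
      _ = 2.8125e-4 * (1 + 1 / 3 * (1 / y ^ 2) + 1 / 9 * (1 / y ^ 2 * (1 / y ^ 2))) *
          (Real.sqrt 2 * G / y ^ 2) := by ring
      _ ≤ 1.6667e-4 * 2 * (Real.sqrt 2 * G / y ^ 2) :=
          mul_le_mul_of_nonneg_right (by linarith) (by positivity)
      _ = _ := by field_simp
  · rw [abs_div, abs_of_pos hs, div_le_iff₀ hs]
    calc |e₂| ≤ Real.sqrt 2 * 2.8125e-4 / y ^ 2 * G := h₂
      _ = 2.8125e-4 * (Real.sqrt 2 * G / y ^ 2) := by ring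
      _ ≤ 1.6667e-4 * 2 * (Real.sqrt 2 * G / y ^ 2) := by gcongr; norm_num
      _ = _ := by field_simp

end Blasius

namespace Blasius

/-! ### Far-field solutions -/

section farField

variable {a b c T : ℝ} {H H₁ H₂ : ℝ → ℝ}

lemma abs_sqrt_two_mul_le (hc : |c| < 1 / 4) : |Real.sqrt 2 * c| ≤ Real.sqrt 2 / 4 := by
  rw [abs_mul, abs_of_nonneg (Real.sqrt_nonneg 2)]
  nlinarith [Real.sqrt_nonneg 2]

lemma exp_neg_sq_sqrt_two_mul {t : ℝ} (ht : 0 ≤ t) :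
    Real.exp (-Real.sqrt (2 * t) ^ 2 / 2) = Real.exp (-t) := by
  rw [Real.sq_sqrt (by positivity)]
  ring_nf

lemma hasDerivWithinAt_source {E p : ℝ}
    (hH : DecayChain p H H₁ H₂ (fun z => -(E * Real.exp (-z ^ 2 / 2) * Real.exp (H z)))) :
    ∀ z ∈ Ici p, HasDerivWithinAt (fun z => E * Real.exp (-z ^ 2 / 2) * Real.exp (H z))
      (-(z + -H₁ z) * (E * Real.exp (-z ^ 2 / 2) * Real.exp (H z))) (Ici p) z := fun z hz =>
  (((hasDerivAt_exp_neg_sq_half z).const_mul E).hasDerivWithinAt.mul (hH.d₀ z hz).exp).congr_deriv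
    (by ring)

lemma continuousOn_source_deriv {E p : ℝ}
    (hH : DecayChain p H H₁ H₂ (fun z => -(E * Real.exp (-z ^ 2 / 2) * Real.exp (H z)))) :
    ContinuousOn (fun z => -(z + -H₁ z) * (E * Real.exp (-z ^ 2 / 2) * Real.exp (H z)))
      (Ici p) := by
  have h1 : ContinuousOn H₁ (Ici p) := fun z hz => (hH.d₁ z hz).continuousWithinAt
  have h2 := hH.continuousOn
  fun_prop

/-- Here `h = -H₁`. Each `x`-derivative contributes a factor `√a`, and the Blasius equation reduces
to the logarithmic derivative of `E e^{-y²/2} e^H` being `-(y + h)`. -/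
theorem isFarFieldSolution_of_decayChain (ha : 0 < a) (hT : 0 < T)
    (hH : DecayChain (Real.sqrt (2 * T)) H H₁ H₂
      (fun z => -(Real.sqrt 2 * c * Real.exp (-z ^ 2 / 2) * Real.exp (H z)))) :
    IsFarFieldSolution a b c T (fun x => Real.sqrt a * (yVar a b x + -H₁ (yVar a b x)))
      (fun t => Real.sqrt (2 * t) * -H₁ (Real.sqrt (2 * t))) := by
  have hp : 0 < Real.sqrt (2 * T) := Real.sqrt_pos.2 (by positivity)
  have hs : 0 < Real.sqrt 2 := by positivity
  have sa : Real.sqrt a * Real.sqrt a = a := Real.mul_self_sqrt ha.le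
  set E := Real.sqrt 2 * c with hE
  set g : ℝ → ℝ := fun z => E * Real.exp (-z ^ 2 / 2) * Real.exp (H z) with hg
  have hm : MapsTo (yVar a b) (Ici (xVar a b (Real.sqrt (2 * T)))) (Ici (Real.sqrt (2 * T))) := by
    rw [← xDomain_eq ha]; exact mapsTo_yVar ha
  have hy := fun x => hasDerivWithinAt_yVar a b x (Ici (xVar a b (Real.sqrt (2 * T))))
  have D₀ : ∀ x ∈ Ici (xVar a b (Real.sqrt (2 * T))), HasDerivWithinAt
      (fun x => Real.sqrt a * (yVar a b x + -H₁ (yVar a b x)))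
      (a * (1 + -H₂ (yVar a b x))) (Ici (xVar a b (Real.sqrt (2 * T)))) x := fun x hx => by
    refine (((hy x).add ((hH.d₁ _ (hm hx)).comp x (hy x) hm).neg).const_mul
      (Real.sqrt a)).congr_deriv ?_
    linear_combination (1 + -H₂ (yVar a b x)) * sa
  have D₁ : ∀ x ∈ Ici (xVar a b (Real.sqrt (2 * T))), HasDerivWithinAt
      (fun x => a * (1 + -H₂ (yVar a b x)))
      (a * Real.sqrt a * g (yVar a b x)) (Ici (xVar a b (Real.sqrt (2 * T)))) x := fun x hx => by
    refine (((hH.d₂ _ (hm hx)).comp x (hy x) hm).neg.const_add 1 |>.const_mul a).congr_deriv ?_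
    simp only [hg]
    ring
  have D₂ : ∀ x ∈ Ici (xVar a b (Real.sqrt (2 * T))), HasDerivWithinAt
      (fun x => a * Real.sqrt a * g (yVar a b x))
      (a ^ 2 * (-(yVar a b x + -H₁ (yVar a b x)) * g (yVar a b x)))
      (Ici (xVar a b (Real.sqrt (2 * T)))) x := fun x hx => by
    refine (((hasDerivWithinAt_source hH _ (hm hx)).comp x (hy x) hm).const_mul
      (a * Real.sqrt a)).congr_deriv ?_
    simp only [hg]
    linear_combination (a * (-(yVar a b x + -H₁ (yVar a b x)) * (E *
      Real.exp (-yVar a b x ^ 2 / 2) * Real.exp (H (yVar a b x))))) * sa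
  have D₃ : ContinuousOn (fun x => a ^ 2 * (-(yVar a b x + -H₁ (yVar a b x)) * g (yVar a b x)))
      (Ici (xVar a b (Real.sqrt (2 * T)))) :=
    ((continuousOn_source_deriv hH).comp (fun x _ => (hy x).continuousWithinAt) hm).const_mul _
  refine ⟨?_, ?_, ?_, ?_⟩
  · rw [xDomain_eq ha]
    refine ⟨contDiffOn_three_of_hasDerivWithinAt D₀ D₁ D₂ D₃, fun x hx => ?_⟩
    rw [eqOn_iteratedDerivWithin_three D₀ D₁ D₂ hx, eqOn_iteratedDerivWithin_two D₀ D₁ hx]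
    linear_combination (a * (yVar a b x + -H₁ (yVar a b x)) * g (yVar a b x)) * sa
  · intro x hx
    have hpos : 0 < yVar a b x := hp.trans_le (mapsTo_yVar ha hx)
    rw [sqrt_form_eq ha hpos, linear_eq ha, tVar_eq ha,
      show 2 * (yVar a b x ^ 2 / 2) = yVar a b x ^ 2 by ring, Real.sqrt_sq hpos.le]
    field_simp
  · have h1 := ((hH.t₁.comp tendsto_sqrt_two_mul).neg).const_mul (Real.sqrt 2)
    rw [neg_zero, mul_zero] at h1
    refine h1.congr' ?_
    filter_upwards [eventually_gt_atTop 0] with t ht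
    have : 0 < Real.sqrt t := Real.sqrt_pos.2 ht
    rw [Function.comp_apply, Real.sqrt_mul zero_le_two]
    field_simp
  · have h1 := ((tendsto_leading hH).comp tendsto_sqrt_two_mul).div_const (Real.sqrt 2)
    rw [hE, mul_div_cancel_left₀ _ hs.ne'] at h1
    refine h1.congr' ?_
    filter_upwards [eventually_gt_atTop 0] with t ht
    have h2 : 0 < Real.sqrt t := Real.sqrt_pos.2 ht
    rw [Function.comp_apply, exp_neg_sq_sqrt_two_mul ht.le, Real.sqrt_mul zero_le_two]
    field_simp

/-- The converse substitution: `h = q / y = F / √a - y` inherits its three derivatives from `F` and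
solves `h''' + (y + h) h'' = 0`. -/
theorem decayChain_of_isFarFieldSolution (ha : 0 < a) (hT : 0 < T) {F q : ℝ → ℝ}
    (h : IsFarFieldSolution a b c T F q) :
    ∃ H H₂ : ℝ → ℝ, DecayChain (Real.sqrt (2 * T)) H (fun y => -(q (y ^ 2 / 2) / y)) H₂
      (fun z => -(Real.sqrt 2 * c * Real.exp (-z ^ 2 / 2) * Real.exp (H z))) := by
  obtain ⟨⟨hF, hode⟩, hform, -, hlead⟩ := h
  have hp : 0 < Real.sqrt (2 * T) := Real.sqrt_pos.2 (by positivity)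
  have hs : 0 < Real.sqrt 2 := by positivity
  have hsa : 0 < Real.sqrt a := Real.sqrt_pos.2 ha
  have sa : Real.sqrt a * Real.sqrt a = a := Real.mul_self_sqrt ha.le
  rw [xDomain_eq ha] at hF hode
  set P := xVar a b (Real.sqrt (2 * T))
  have hm : MapsTo (xVar a b) (Ici (Real.sqrt (2 * T))) (Ici P) := fun y hy => xVar_mono ha hy
  have hx := fun y => hasDerivWithinAt_xVar a b y (Ici (Real.sqrt (2 * T)))
  have hq : ∀ y ∈ Ici (Real.sqrt (2 * T)),
      q (y ^ 2 / 2) / y = F (xVar a b y) / Real.sqrt a - y := fun y hy => by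
    have hy0 : 0 < y := hp.trans_le hy
    have h1 := hform _ (mapsTo_xVar ha hy)
    rw [sqrt_form_eq ha (by rwa [yVar_xVar ha]), linear_eq ha, tVar_eq ha, yVar_xVar ha] at h1
    rw [h1]
    field_simp
    ring
  have D₀ : ∀ y ∈ Ici (Real.sqrt (2 * T)), HasDerivWithinAt (fun y => q (y ^ 2 / 2) / y)
      (iteratedDerivWithin 1 F (Ici P) (xVar a b y) / a - 1) (Ici (Real.sqrt (2 * T))) y :=
    fun y hy => by
      have h0 := hasDerivWithinAt_iteratedDerivWithin (n := 3) (m := 0) hF (by norm_num)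
        (xVar a b y) (hm hy)
      rw [iteratedDerivWithin_zero] at h0
      have h1 := ((h0.comp y (hx y) hm).div_const (Real.sqrt a)).sub (hasDerivWithinAt_id y _)
      refine (h1.congr (fun z hz => hq z hz) (hq y hy)).congr_deriv ?_
      rw [mul_one_div, div_div, sa]
  have D₁ : ∀ y ∈ Ici (Real.sqrt (2 * T)), HasDerivWithinAt
      (fun y => iteratedDerivWithin 1 F (Ici P) (xVar a b y) / a - 1)
      (iteratedDerivWithin 2 F (Ici P) (xVar a b y) / (a * Real.sqrt a))
      (Ici (Real.sqrt (2 * T))) y := fun y hy => by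
    have h0 := hasDerivWithinAt_iteratedDerivWithin (n := 3) (m := 1) hF (by norm_num)
      (xVar a b y) (hm hy)
    refine (((h0.comp y (hx y) hm).div_const a).sub_const 1).congr_deriv ?_
    rw [mul_one_div, div_div, mul_comm a]
  have D₂ : ∀ y ∈ Ici (Real.sqrt (2 * T)), HasDerivWithinAt
      (fun y => iteratedDerivWithin 2 F (Ici P) (xVar a b y) / (a * Real.sqrt a))
      (-(y + q (y ^ 2 / 2) / y) * (iteratedDerivWithin 2 F (Ici P) (xVar a b y) /
        (a * Real.sqrt a))) (Ici (Real.sqrt (2 * T))) y := fun y hy => by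
    have h0 := hasDerivWithinAt_iteratedDerivWithin (n := 3) (m := 2) hF (by norm_num)
      (xVar a b y) (hm hy)
    refine ((h0.comp y (hx y) hm).div_const (a * Real.sqrt a)).congr_deriv ?_
    have h1 := hode (xVar a b y) (hm hy)
    rw [hq y hy, eq_neg_of_add_eq_zero_left h1]
    field_simp
    ring
  have hl : Tendsto (fun y => q (y ^ 2 / 2) / y / (Real.exp (-y ^ 2 / 2) / y ^ 2)) atTop
      (𝓝 (Real.sqrt 2 * c)) := by
    refine ((hlead.comp tendsto_sq_half).const_mul (Real.sqrt 2)).congr' ?_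
    filter_upwards [eventually_gt_atTop 0] with y hy
    rw [Function.comp_apply, Real.sqrt_div (sq_nonneg y), Real.sqrt_sq hy.le, ← neg_div]
    field_simp
  exact exists_decayChain_of_solution D₀ D₁ D₂ hl

theorem eqOn_of_isFarFieldSolution (ha : 0 < a) (hT : 0 < T) {F q F' q' : ℝ → ℝ}
    (h : IsFarFieldSolution a b c T F q) (h' : IsFarFieldSolution a b c T F' q') :
    EqOn F' F (xDomain a b T) ∧ EqOn q' q (Ici T) := by
  have hp : 0 < Real.sqrt (2 * T) := Real.sqrt_pos.2 (by positivity)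
  obtain ⟨H, H₂, hH⟩ := decayChain_of_isFarFieldSolution ha hT h
  obtain ⟨G, G₂, hG⟩ := decayChain_of_isFarFieldSolution ha hT h'
  have key := eqOn_of_decayChain hG hH
  have hq : EqOn q' q (Ici T) := fun t ht => by
    have ht0 : 0 < t := hT.trans_le ht
    have h1 := key (sqrt_two_mul_mem ht)
    have hy : 0 < Real.sqrt (2 * t) := hp.trans_le (sqrt_two_mul_mem ht)
    have h2 : Real.sqrt (2 * t) ^ 2 / 2 = t := by
      rw [Real.sq_sqrt (by positivity)]; ring
    simp only [h2, neg_inj] at h1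
    exact (div_left_inj' hy.ne').1 h1
  refine ⟨fun x hx => ?_, hq⟩
  have hmem : tVar a b x ∈ Ici T := by
    have h1 : Real.sqrt (2 * T) ≤ yVar a b x := mapsTo_yVar ha hx
    have h2 := pow_le_pow_left₀ hp.le h1 2
    rw [Real.sq_sqrt (by positivity)] at h2
    rw [mem_Ici, tVar_eq ha]
    linarith
  rw [h'.form x hx, h.form x hx, hq hmem]

/-! ### The error term -/

lemma continuous_gaussTail : Continuous gaussTail :=
  continuous_iff_continuousAt.2 fun y => (hasDerivAt_gaussTail y).continuousAt

lemma continuous_gaussTail₃ : Continuous gaussTail₃ :=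
  continuous_iff_continuousAt.2 fun y => (hasDerivAt_gaussTail₃ y).continuousAt

/-- The derivative of the error term in the variable `t`, where `e` is the error in the
variable `y = √(2t)`. -/
lemma hasDerivWithinAt_error {e e₁ : ℝ → ℝ} (hT : 0 < T)
    (he : ∀ y ∈ Ici (Real.sqrt (2 * T)), HasDerivWithinAt e (e₁ y) (Ici (Real.sqrt (2 * T))) y) :
    ∀ t ∈ Ici T, HasDerivWithinAt (fun t => Real.sqrt (2 * t) * e (Real.sqrt (2 * t)))
      (e₁ (Real.sqrt (2 * t)) + e (Real.sqrt (2 * t)) / Real.sqrt (2 * t)) (Ici T) t := by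
  intro t ht
  have ht0 : 0 < t := hT.trans_le ht
  have hy : 0 < Real.sqrt (2 * t) := Real.sqrt_pos.2 (by positivity)
  have hd := (hasDerivAt_sqrt_two_mul ht0).hasDerivWithinAt (s := Ici T)
  refine (hd.mul ((he _ (sqrt_two_mul_mem ht)).comp t hd
    fun _ => sqrt_two_mul_mem)).congr_deriv ?_
  simp only [Function.comp_apply]
  field_simp
  ring

lemma hasDerivWithinAt_error_deriv {e e₁ e₂ : ℝ → ℝ} (hT : 0 < T)
    (he : ∀ y ∈ Ici (Real.sqrt (2 * T)), HasDerivWithinAt e (e₁ y) (Ici (Real.sqrt (2 * T))) y)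
    (he₁ : ∀ y ∈ Ici (Real.sqrt (2 * T)),
      HasDerivWithinAt e₁ (e₂ y) (Ici (Real.sqrt (2 * T))) y) :
    ∀ t ∈ Ici T, HasDerivWithinAt
      (fun t => e₁ (Real.sqrt (2 * t)) + e (Real.sqrt (2 * t)) / Real.sqrt (2 * t))
      ((e₂ (Real.sqrt (2 * t)) + e₁ (Real.sqrt (2 * t)) / Real.sqrt (2 * t)
        - e (Real.sqrt (2 * t)) / Real.sqrt (2 * t) ^ 2) / Real.sqrt (2 * t)) (Ici T) t := by
  intro t ht
  have ht0 : 0 < t := hT.trans_le ht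
  have hy : 0 < Real.sqrt (2 * t) := Real.sqrt_pos.2 (by positivity)
  have hd := (hasDerivAt_sqrt_two_mul ht0).hasDerivWithinAt (s := Ici T)
  have c₁ := (he₁ _ (sqrt_two_mul_mem ht)).comp t hd fun _ => sqrt_two_mul_mem
  have c₀ := (he _ (sqrt_two_mul_mem ht)).comp t hd fun _ => sqrt_two_mul_mem
  refine (c₁.add (c₀.div hd hy.ne')).congr_deriv ?_
  simp only [Function.comp_apply]
  field_simp
  ring

lemma contDiffOn_error {e : ℝ → ℝ} (hT : 0 < T)
    (he : ContDiffOn ℝ 3 e (Ici (Real.sqrt (2 * T)))) :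
    ContDiffOn ℝ 3 (fun t => Real.sqrt (2 * t) * e (Real.sqrt (2 * t))) (Ici T) := by
  have hs : ContDiffOn ℝ 3 (fun t : ℝ => Real.sqrt (2 * t)) (Ici T) := by
    refine ContDiffOn.sqrt (by fun_prop) fun t ht => ?_
    have : 0 < t := hT.trans_le ht
    positivity
  exact hs.mul (he.comp hs fun _ => sqrt_two_mul_mem)

/-- With `ℰ = y e`, the combinations to be bounded are exactly `y e`, `e₁`, `(e₂ - e₁/y - e/y²) /
√2` and `e₂ / √2`. The bounds on `e₁` and `e` follow by integrating the one on `e₂`. -/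
theorem error_bounds {e e₁ e₂ : ℝ → ℝ} (hT : 1.99 ≤ T)
    (he : ∀ y ∈ Ici (Real.sqrt (2 * T)), HasDerivWithinAt e (e₁ y) (Ici (Real.sqrt (2 * T))) y)
    (he₁ : ∀ y ∈ Ici (Real.sqrt (2 * T)),
      HasDerivWithinAt e₁ (e₂ y) (Ici (Real.sqrt (2 * T))) y)
    (t₀ : Tendsto e atTop (𝓝 0)) (t₁ : Tendsto e₁ atTop (𝓝 0))
    (hb : ∀ y ∈ Ici (Real.sqrt (2 * T)), |e₂ y| ≤
      Real.sqrt 2 * 2.8125e-4 / y ^ 2 * Real.exp (-3 * y ^ 2 / 2)) {ℰ : ℝ → ℝ}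
    (hℰ : ℰ = fun t => Real.sqrt (2 * t) * e (Real.sqrt (2 * t))) :
    ∀ t ∈ Ici T,
      |ℰ t| ≤ (1.6667e-4 : ℝ) * (Real.exp (-3 * t) / (9 * t ^ (3 / 2 : ℝ))) ∧
      |derivWithin ℰ (Ici T) t - 1 / (2 * t) * ℰ t|
        ≤ (1.6667e-4 : ℝ) * (Real.exp (-3 * t) / (3 * t ^ (3 / 2 : ℝ))) ∧
      |Real.sqrt t * iteratedDerivWithin 2 ℰ (Ici T) t
          - 1 / Real.sqrt t * derivWithin ℰ (Ici T) t
          + 1 / (2 * t ^ (3 / 2 : ℝ)) * ℰ t|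
        ≤ (1.6667e-4 : ℝ) * (t⁻¹ * Real.exp (-3 * t)) ∧
      |Real.sqrt t * iteratedDerivWithin 2 ℰ (Ici T) t
          - 1 / (2 * Real.sqrt t) * derivWithin ℰ (Ici T) t
          + 1 / (2 * t ^ (3 / 2 : ℝ)) * ℰ t|
        ≤ (1.6667e-4 : ℝ) * (t⁻¹ * Real.exp (-3 * t)) := by
  intro t ht
  have hT0 : 0 < T := by linarith
  have hp : 0 < Real.sqrt (2 * T) := Real.sqrt_pos.2 (by positivity)
  have hb₁ := abs_le_of_abs_deriv_le_gaussian hp (by positivity) he₁ hb t₁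
  have hb₀ := abs_le_of_abs_deriv_le_gaussian hp (by positivity) he hb₁ t₀
  have hd := hasDerivWithinAt_error hT0 he
  have hd₁ := hasDerivWithinAt_error_deriv hT0 he he₁
  rw [← hℰ] at hd
  rw [eqOn_derivWithin_Ici hd ht, eqOn_iteratedDerivWithin_two hd hd₁ ht, hℰ]
  have hmem := sqrt_two_mul_mem ht
  have ht' : T ≤ t := ht
  have hsq : Real.sqrt (2 * t) ^ 2 = 2 * t := Real.sq_sqrt (by linarith)
  have hy : 0 < Real.sqrt (2 * t) := hp.trans_le hmem
  have hy2 : 3.98 ≤ Real.sqrt (2 * t) ^ 2 := by rw [hsq]; linarith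
  set y := Real.sqrt (2 * t)
  have hty : t = y ^ 2 / 2 := by linarith
  have key := bounds_of_bounds hy hy2 (Real.exp_pos _) (hb₀ y hmem) (hb₁ y hmem) (hb y hmem)
  have hst : Real.sqrt (y ^ 2 / 2) = y / Real.sqrt 2 := by
    rw [Real.sqrt_div (sq_nonneg y), Real.sqrt_sq hy.le]
  have s2 : Real.sqrt 2 ^ 2 = 2 := Real.sq_sqrt (by norm_num)
  have hs : 0 < Real.sqrt 2 := by positivity
  rw [hty, rpow_three_halves hy, hst, show -3 * (y ^ 2 / 2) = -3 * y ^ 2 / 2 by ring]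
  have hyy : Real.sqrt (2 * (y ^ 2 / 2)) = y := by rw [← hty]
  simp only [hyy]
  obtain ⟨k1, k2, k3, k4⟩ := key
  refine ⟨k1, ?_, ?_, ?_⟩
  · convert k2 using 2
    field_simp
    ring
  · convert k3 using 2
    field_simp
    rw [s2]
    ring
  · convert k4 using 2
    field_simp
    rw [s2]
    ring

end farField

end Blasius

/-! ### The main theorem -/

theorem proposition3 (a b c T : ℝ) (ha : 0 < a) (hc : |c| < 1 / 4) (hT : (1.99 : ℝ) ≤ T) :
    ∃ F q : ℝ → ℝ,
      Blasius.IsFarFieldSolution a b c T F q ∧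
      (∀ F' q' : ℝ → ℝ, Blasius.IsFarFieldSolution a b c T F' q' →
        EqOn F' F (Blasius.xDomain a b T) ∧ EqOn q' q (Ici T)) ∧
      ∃ ℰ : ℝ → ℝ,
        (∀ t ∈ Ici T, q t = Blasius.q₀ c t + ℰ t) ∧
        ContDiffOn ℝ 3 ℰ (Ici T) ∧
        ∀ t ∈ Ici T,
          |ℰ t| ≤ (1.6667e-4 : ℝ) * (Real.exp (-3 * t) / (9 * t ^ (3 / 2 : ℝ))) ∧
          |derivWithin ℰ (Ici T) t - 1 / (2 * t) * ℰ t|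
            ≤ (1.6667e-4 : ℝ) * (Real.exp (-3 * t) / (3 * t ^ (3 / 2 : ℝ))) ∧
          |Real.sqrt t * iteratedDerivWithin 2 ℰ (Ici T) t
              - 1 / Real.sqrt t * derivWithin ℰ (Ici T) t
              + 1 / (2 * t ^ (3 / 2 : ℝ)) * ℰ t|
            ≤ (1.6667e-4 : ℝ) * (t⁻¹ * Real.exp (-3 * t)) ∧
          |Real.sqrt t * iteratedDerivWithin 2 ℰ (Ici T) t
              - 1 / (2 * Real.sqrt t) * derivWithin ℰ (Ici T) t
              + 1 / (2 * t ^ (3 / 2 : ℝ)) * ℰ t|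
            ≤ (1.6667e-4 : ℝ) * (t⁻¹ * Real.exp (-3 * t)) := by
  have hT0 : 0 < T := by linarith
  have hp : 0 < Real.sqrt (2 * T) := Real.sqrt_pos.2 (by positivity)
  have hp2 : 3.98 ≤ Real.sqrt (2 * T) ^ 2 := by
    rw [Real.sq_sqrt (by positivity)]; linarith
  have hE := Blasius.abs_sqrt_two_mul_le hc
  obtain ⟨H, H₁, H₂, hH, hb⟩ := Blasius.exists_decayChain
    ((Blasius.abs_const_le hE).trans (by norm_num)) (Blasius.le_of_sq_ge hp hp2)
  have hsol := Blasius.isFarFieldSolution_of_decayChain (b := b) ha hT0 hH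
  refine ⟨_, _, hsol, fun F' q' h => Blasius.eqOn_of_isFarFieldSolution ha hT0 hsol h, ?_⟩
  set E := Real.sqrt 2 * c with hEdef
  have e₀ : ∀ y ∈ Ici (Real.sqrt (2 * T)), HasDerivWithinAt (fun y => -H₁ y - Blasius.quasi E y)
      (-H₂ y - Blasius.quasiDeriv E y) (Ici (Real.sqrt (2 * T))) y := fun y hy =>
    (hH.d₁ y hy).neg.sub (Blasius.hasDerivAt_quasi E y).hasDerivWithinAt
  have e₁ : ∀ y ∈ Ici (Real.sqrt (2 * T)),
      HasDerivWithinAt (fun y => -H₂ y - Blasius.quasiDeriv E y)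
      (E * Real.exp (-y ^ 2 / 2) * Real.exp (H y) - Blasius.quasiDeriv₂ E y)
      (Ici (Real.sqrt (2 * T))) y := fun y hy =>
    ((hH.d₂ y hy).neg.sub (Blasius.hasDerivAt_quasiDeriv E y).hasDerivWithinAt).congr_deriv
      (by rw [neg_neg])
  -- This third derivative of the error in `y` is needed only for the `C³` claim.
  have e₂ := fun y hy => (Blasius.hasDerivWithinAt_source hH y hy).sub
    (Blasius.hasDerivAt_quasiDeriv₂ E y).hasDerivWithinAt
  refine ⟨fun t => Real.sqrt (2 * t) *
    (-H₁ (Real.sqrt (2 * t)) - Blasius.quasi E (Real.sqrt (2 * t))), fun t ht => ?_, ?_, ?_⟩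
  · have hy : 0 < Real.sqrt (2 * t) := hp.trans_le (Blasius.sqrt_two_mul_mem ht)
    have h1 := Blasius.q₀_eq c hy
    have ht0 : 0 < t := hT0.trans_le ht
    rw [Real.sq_sqrt (by positivity), mul_div_cancel_left₀ t two_ne_zero, ← hEdef] at h1
    rw [h1]
    ring
  · refine Blasius.contDiffOn_error (e := fun y => -H₁ y - Blasius.quasi E y) hT0
      (Blasius.contDiffOn_three_of_hasDerivWithinAt e₀ e₁ e₂
        ((Blasius.continuousOn_source_deriv hH).sub (Continuous.continuousOn ?_)))
    have h1 := Blasius.continuous_gaussTail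
    have h2 := Blasius.continuous_gaussTail₃
    fun_prop
  · exact Blasius.error_bounds hT e₀ e₁ (by simpa using hH.t₁.neg.sub (Blasius.tendsto_quasi E))
      (by simpa using hH.t₂.neg.sub (Blasius.tendsto_quasiDeriv E))
      (Blasius.abs_error₂_le hp hp2 hE hH hb) rfl
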